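/- **Setting.** Let $d,T\ge 1$ be integers with $dT\ge 2$, let $\mathcal K\subset\mathbb R^d$ be a compact convex set with $\mathbf 0\in\mathcal K$, and let $D\ge 1/T$ be such that $\|w\|\le D$ for all $w\in\mathcal K$ ($\|\cdot\|$ is the Euclidean norm). In each round $t=1,\dots,T$ the learner receives a prediction $m_t\in\mathbb R^d$, plays $w_t\in\mathcal K$ and then observes the loss $\ell_t\in\mathbb R^d$, where $\|\ell_t-m_t\|\le 1$. Put $\mathrm{Reg}(u)=\sum_{t=1}^T\langle w_t-u,\ell_t\rangle$ and $\mathcal L_T=\sum_{t=1}^T(\ell_t-m_t)(\ell_t-m_t)^\top$. **Base algorithm** (optimistic full-matrix AdaGrad with decision set $\Omega$ and parameters $\eta,\eta'>0$). In round $t$ it plays $$w_t=\operatorname*{argmin}_{w\in\Omega}\Big\{\Big\langle w,\textstyle\sum_{s<t}\nabla_s+m_t\Big\rangle+\tfrac1{2\eta}\,w^\top\Big(I+\textstyle\sum_{s<t}(\nabla_s-m_s)(\nabla_s-m_s)^\top\Big)^{1/2}w\Big\},$$ where $\nabla_s=\ell_s+32\eta'\langle w_s,\ell_s-m_s\rangle(\ell_s-m_s)$.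 **Experts.** Let $\mathcal S$ be the set of all integer triples $k=(d_k,t_k,l_k)$ with $-\lceil\log_2T\rceil\le d_k\le\lceil\log_2D\rceil$, $1\le t_k\le\lceil\log_2(dT)\rceil$ and $-\lceil\log_2T\rceil\le l_k\le\lceil\log_2(2D^2T)\rceil$. For $k\in\mathcal S$ put $\eta_k=\frac1{64\cdot2^{d_k+t_k}}$ and let $\mathcal A_k$ be the base algorithm with $\Omega=\mathcal K\cap\{w:\|w\|\le2^{d_k}\}$, $\eta=2^{l_k+1}\eta_k$ and $\eta'=2\eta_k$. **Master** (MsMwC-Master with the experts $(\eta_k,\mathcal A_k)_{k\in\mathcal S}$ and the full simplex $\Delta_{\mathcal S}$ in every round). Let $D_\psi(p,q)=\sum_{k}\frac1{\eta_k}\big(p_k\ln\frac{p_k}{q_k}-p_k+q_k\big)$ and $p'_{1,k}=\eta_k^2/\sum_j\eta_j^2$. In round $t$, every $\mathcal A_k$ is given $m_t$ and returns $w_t^k$; with $h_{t,k}=\langle w_t^k,m_t\rangle$ the master computes $$p_t=\operatorname*{argmin}_{p\in\Delta_{\mathcal S}}\{\langle p,h_t\rangle+D_\psi(p,p'_t)\}$$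 and plays $w_t=\sum_kp_{t,k}w_t^k$. It receives $\ell_t$, passes it to every $\mathcal A_k$, and with $g_{t,k}=\langle w_t^k,\ell_t\rangle$ and $b_{t,k}=32\eta_k(g_{t,k}-h_{t,k})^2$ computes $$p'_{t+1}=\operatorname*{argmin}_{p\in\Delta_{\mathcal S}}\{\langle p,g_t+b_t\rangle+D_\psi(p,p'_t)\}.$$ **Theorem.** There is an absolute constant $C>0$ such that in this setting, for all sequences of predictions and losses, the regret of this master algorithm satisfies, for all $u\in\mathcal K$, $$\mathrm{Reg}(u)\le C\ln\!\big(T(1+D)\big)\Big(1+\|u\|+\sqrt{\big(u^\top(I+\mathcal L_T)^{1/2}u\big)\,\mathrm{tr}\big(\mathcal L_T^{1/2}\big)}\Big),$$ and for all $u\in\mathcal K$ with $\|u\|\ge 1/\sqrt T$ the bound also holds without the summand $1$, that is, $$\mathrm{Reg}(u)\le C\ln\!\big(T(1+D)\big)\Big(\|u\|+\sqrt{\big(u^\top(I+\mathcal L_T)^{1/2}u\big)\,\mathrm{tr}\big(\mathcal L_T^{1/2}\big)}\Big).$$ -/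

import Mathlib

open scoped RealInnerProductSpace MatrixOrder

noncomputable section

namespace OnlineLinear

/-- The space `ℝ^d` with its Euclidean norm. -/
abbrev Vec (d : ℕ) := EuclideanSpace ℝ (Fin d)

/-- A minimiser of `f` over the set `S` (an arbitrary point if there is none). -/
def argmin {α : Type} [Nonempty α] (S : Set α) (f : α → ℝ) : α :=
  Classical.epsilon fun x => x ∈ S ∧ ∀ y ∈ S, f x ≤ f y

/-- A deterministic algorithm for online linear optimization with predictions. In every round it
plays `decide σ m` for its current state `σ` and the prediction `m`, then sees the loss `ℓ` and
moves to the state `update σ m ℓ`. -/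
structure Algorithm (d : ℕ) where
  State : Type
  init : State
  decide : State → Vec d → Vec d
  update : State → Vec d → Vec d → State

namespace Algorithm

variable {d : ℕ}

/-- The state after `t` rounds (rounds are numbered `0, 1, 2, …`). -/
def state (A : Algorithm d) (ℓ m : ℕ → Vec d) : ℕ → A.State
  | 0 => A.init
  | t + 1 => A.update (A.state ℓ m t) (m t) (ℓ t)

/-- The decision `w_t` played in round `t`. -/
def play (A : Algorithm d) (ℓ m : ℕ → Vec d) (t : ℕ) : Vec d :=
  A.decide (A.state ℓ m t) (m t)

/-- The regret `∑_t ⟪w_t - u, ℓ_t⟫` of the first `T` rounds against `u`. -/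
def regret (A : Algorithm d) (ℓ m : ℕ → Vec d) (T : ℕ) (u : Vec d) : ℝ :=
  ∑ t ∈ Finset.range T, ⟪A.play ℓ m t - u, ℓ t⟫

end Algorithm

/-- The rank-one matrix `v vᵀ`. -/
def outer {d : ℕ} (v : Vec d) : Matrix (Fin d) (Fin d) ℝ :=
  Matrix.vecMulVec v.ofLp v.ofLp

/-- The quadratic form `wᵀ A w`. -/
def quadForm {d : ℕ} (A : Matrix (Fin d) (Fin d) ℝ) (w : Vec d) : ℝ :=
  w.ofLp ⬝ᵥ (A.mulVec w.ofLp)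

/-- The matrix `∑_{t < T} (ℓ_t - m_t)(ℓ_t - m_t)ᵀ`. -/
def lossMatrix {d : ℕ} (ℓ m : ℕ → Vec d) (T : ℕ) : Matrix (Fin d) (Fin d) ℝ :=
  ∑ t ∈ Finset.range T, outer (ℓ t - m t)

/-- The quantity `‖u‖ + sqrt (uᵀ (I + L)^{1/2} u · tr (L^{1/2}))` for `L = lossMatrix ℓ m T`. -/
def agBound {d : ℕ} (ℓ m : ℕ → Vec d) (T : ℕ) (u : Vec d) : ℝ :=
  ‖u‖ + √(quadForm (CFC.sqrt (1 + lossMatrix ℓ m T)) u * (CFC.sqrt (lossMatrix ℓ m T)).trace)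

section AdaGrad

variable {d : ℕ}

/-- The state of optimistic AdaGrad after `t` rounds: the sum of the `∇_s` and the sum of the
`(∇_s - m_s)(∇_s - m_s)ᵀ` over the past rounds `s`. -/
structure AdaGradState (d : ℕ) where
  gradSum : Vec d
  gradMatrix : Matrix (Fin d) (Fin d) ℝ

/-- The AdaGrad decision: a minimiser over `Ω` of `⟪w, ∑_s ∇_s + m⟫ + (1/2) wᵀ A w`, where
`A = (1/η) (I + G)^{1/2}` and `G = ∑_s (∇_s - m_s)(∇_s - m_s)ᵀ`. -/
def adaGradDecide (Ω : Set (Vec d)) (η : ℝ) (σ : AdaGradState d) (m : Vec d) : Vec d :=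
  argmin Ω fun w =>
    ⟪w, σ.gradSum + m⟫ + (1 / 2) * quadForm ((1 / η) • CFC.sqrt (1 + σ.gradMatrix)) w

/-- The gradient at `w` of the cost `c(w) = ⟪w, ℓ⟫ + 16 η' ⟪w, ℓ - m⟫²`. -/
def adaGradGradient (η' : ℝ) (w m ℓ : Vec d) : Vec d :=
  ℓ + (32 * η' * ⟪w, ℓ - m⟫) • (ℓ - m)

/-- Optimistic full-matrix AdaGrad with decision set `Ω` and learning rates `η`, `η'`. -/
def adaGrad (Ω : Set (Vec d)) (η η' : ℝ) : Algorithm d where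
  State := AdaGradState d
  init := ⟨0, 0⟩
  decide := adaGradDecide Ω η
  update σ m ℓ :=
    let g := adaGradGradient η' (adaGradDecide Ω η σ m) m ℓ
    ⟨σ.gradSum + g, σ.gradMatrix + outer (g - m)⟩

end AdaGrad

section Master

variable {d : ℕ} {ι : Type} [Fintype ι]

/-- The Bregman divergence `D_ψ(p, q)` of the weighted negative entropy
`ψ(p) = ∑_k (1/η_k) p_k ln p_k`, written out (for `q` with positive entries). -/
def entropyDiv (η : ι → ℝ) (p q : ι → ℝ) : ℝ :=
  ∑ k, (1 / η k) * (p k * Real.log (p k / q k) - p k + q k)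

/-- The state of the master: the states of all base algorithms and the auxiliary weights `p'`. -/
structure MasterState (A : ι → Algorithm d) where
  base : ∀ k, (A k).State
  aux : ι → ℝ

/-- The weights `p_t`: a minimiser over `Λ` of `⟨p, h⟩ + D_ψ(p, p')` with `h_k = ⟪w^k, m⟫`. -/
def masterWeights (η : ι → ℝ) (A : ι → Algorithm d) (Λ : Set (ι → ℝ))
    (σ : MasterState A) (m : Vec d) : ι → ℝ :=
  argmin Λ fun p =>
    (∑ k, p k * ⟪(A k).decide (σ.base k) m, m⟫) + entropyDiv η p σ.aux

/-- The updated auxiliary weights `p'`: a minimiser over `Λ` of `⟨p, g + b⟩ + D_ψ(p, p')`, where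
`g_k = ⟪w^k, ℓ⟫` and `b_k = 32 η_k (g_k - h_k)²`. -/
def masterAux (η : ι → ℝ) (A : ι → Algorithm d) (Λ : Set (ι → ℝ))
    (σ : MasterState A) (m ℓ : Vec d) : ι → ℝ :=
  argmin Λ fun p =>
    (∑ k, p k *
      (⟪(A k).decide (σ.base k) m, ℓ⟫ +
        32 * η k * (⟪(A k).decide (σ.base k) m, ℓ⟫ - ⟪(A k).decide (σ.base k) m, m⟫) ^ 2))
      + entropyDiv η p σ.aux

/-- The master algorithm MsMwC-Master over the experts `(η_k, A_k)`, with weights restricted to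
`Λ` in every round. -/
def msMwCMaster (η : ι → ℝ) (A : ι → Algorithm d) (Λ : Set (ι → ℝ)) : Algorithm d where
  State := MasterState A
  init := ⟨fun k => (A k).init, fun k => η k ^ 2 / ∑ j, η j ^ 2⟩
  decide σ m := ∑ k, masterWeights η A Λ σ m k • (A k).decide (σ.base k) m
  update σ m ℓ :=
    ⟨fun k => (A k).update (σ.base k) m ℓ, masterAux η A Λ σ m ℓ⟩

end Master

section Experts

/-- The grid of parameters `k = (d_k, t_k, l_k)`. -/
def agGrid (d T : ℕ) (D : ℝ) : Finset (ℤ × ℤ × ℤ) :=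
  Finset.Icc (-⌈Real.logb 2 T⌉) ⌈Real.logb 2 D⌉ ×ˢ
    Finset.Icc 1 ⌈Real.logb 2 (d * T)⌉ ×ˢ
      Finset.Icc (-⌈Real.logb 2 T⌉) ⌈Real.logb 2 (2 * D ^ 2 * T)⌉

/-- The learning rate `η_k = 1 / (64 · 2^(d_k + t_k))`. -/
def agRate (k : ℤ × ℤ × ℤ) : ℝ :=
  1 / (64 * 2 ^ (k.1 + k.2.1))

/-- The base algorithm of the parameter `k`: optimistic AdaGrad over `K ∩ {w : ‖w‖ ≤ 2^(d_k)}` with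
`η = 2^(l_k + 1) η_k` and `η' = 2 η_k`. -/
def agBase {d : ℕ} (K : Set (Vec d)) (k : ℤ × ℤ × ℤ) : Algorithm d :=
  adaGrad (K ∩ {w | ‖w‖ ≤ 2 ^ k.1}) (2 ^ (k.2.2 + 1) * agRate k) (2 * agRate k)

/-- MsMwC-Master with the expert set of all AdaGrad instances of the grid, and with `Λ` the full
simplex. -/
def agMaster {d : ℕ} (K : Set (Vec d)) (T : ℕ) (D : ℝ) : Algorithm d :=
  msMwCMaster (ι := {k // k ∈ agGrid d T D}) (fun k => agRate k) (fun k => agBase K k)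
    (stdSimplex ℝ {k // k ∈ agGrid d T D})

end Experts

end OnlineLinear

end

/-!
The bound combines two regret guarantees and a choice of one expert.

*Master.* The entropic update over the full simplex is explicit: the minimiser of
`⟨p, x⟩ + D_ψ(p, q)` is an exponential reweighting of `q`, and the objective exceeds its minimum at
`u` by exactly `D_ψ(u, p)` (`argmin_entropyDiv_spec`). Hence one round of optimistic mirror descent
costs at most a difference of divergences plus a stability term, which is dominated by the
correction `b` because `η_k |g_k - h_k| ≤ 1/128` (`optimistic_step_le`). Summed over the rounds, the
regret against the expert `k` is at most
`(1/η_k) ln (∑ η_j² / η_k²) + ∑ η_j / ∑ η_j² + 32 η_k ∑_t ⟪w_t^k, ℓ_t - m_t⟫²`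
(`msMwCMaster_regret_le`).

*AdaGrad.* Running on the gradients of `⟪w, ℓ⟫ + 16 η' ⟪w, ℓ - m⟫²` with `η' = 2 η_k`, the expert
replaces the second-order term of its own decisions, which the master pays, by that of the
comparator, `32 η_k uᵀ L u` (`adaGrad_regret_le`). Its linear regret is bounded by induction on the
regularised cumulative loss (`adaGrad_potential`); the penalty of a round is at most the increase of
`2 η tr (I + G)^{1/2}` (`inner_sub_quadForm_le`). The matrix facts needed are the operator
monotonicity of the square root (`le_of_mul_self_le_mul_self`), the trace inequality
`gᵀ P⁻¹ g ≤ 2 (tr P - tr Q)` for `P² = Q² + g gᵀ`, and `tr L^{1/2} ≤ T`, which comes from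
`rank L ≤ T` and keeps the dimension out of the logarithm (`trace_sqrt_lossMatrix_le`).

*Tuning.* Write `V = uᵀ (I + L)^{1/2} u` and `τ = tr L^{1/2}`. Since `uᵀ L u ≤ V τ`, an expert with
`2^{d_k} ≈ ‖u‖`, `1/η_k ≈ B = ‖u‖ + √(V τ)` and `2^{l_k} ≈ V` has regret of order `B` times the
logarithm. As `‖u‖² ≤ V ≤ (1 + T) ‖u‖²` and `τ ≤ T`, these scales lie within the grid when
`‖u‖ ≥ 1/√T`; for smaller comparators they are rounded up to `1/T`, which costs the summand `1`
(`agMaster_regret_le_of_scales`).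
-/

noncomputable section

namespace OnlineLinear

/-! ### Square roots of positive semidefinite matrices -/

section SqrtOrder

variable {n : Type} [Fintype n]

theorem dotProduct_mulVec_symm {A : Matrix n n ℝ} (hA : A.IsHermitian) (x y : n → ℝ) :
    x ⬝ᵥ A.mulVec y = A.mulVec x ⬝ᵥ y := by
  rw [Matrix.dotProduct_mulVec, ← Matrix.mulVec_transpose]
  congr 2

theorem dotProduct_mulVec_mono {A B : Matrix n n ℝ} (h : A ≤ B) (x : n → ℝ) :
    x ⬝ᵥ A.mulVec x ≤ x ⬝ᵥ B.mulVec x := by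
  have := (Matrix.le_iff.1 h).dotProduct_mulVec_nonneg x
  simp only [star_trivial, Matrix.sub_mulVec, dotProduct_sub] at this
  linarith

theorem trace_mono {A B : Matrix n n ℝ} (h : A ≤ B) : A.trace ≤ B.trace := by
  have := (Matrix.le_iff.1 h).trace_nonneg
  rw [Matrix.trace_sub] at this
  linarith

variable [DecidableEq n]

/-- Operator monotonicity of the square root, stated for squares. If `B - A` had an eigenvector `v`
with eigenvalue `μ < 0`, then `vᵀ (B² - A²) v = 2 μ vᵀ B v - μ² ‖v‖² < 0`. -/
theorem le_of_mul_self_le_mul_self {A B : Matrix n n ℝ} (hA : 0 ≤ A) (hB : 0 ≤ B)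
    (h : A * A ≤ B * B) : A ≤ B := by
  have hA' := Matrix.nonneg_iff_posSemidef.1 hA
  have hB' := Matrix.nonneg_iff_posSemidef.1 hB
  have hM : (B - A).IsHermitian := hB'.isHermitian.sub hA'.isHermitian
  rw [Matrix.le_iff, hM.posSemidef_iff_eigenvalues_nonneg]
  intro i
  by_contra hneg
  simp only [Pi.zero_apply, not_le] at hneg
  set μ := hM.eigenvalues i
  set v : n → ℝ := (hM.eigenvectorBasis i).ofLp
  have hv : (B - A).mulVec v = μ • v := hM.mulVec_eigenvectorBasis i
  have hvv : v ⬝ᵥ v = 1 := by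
    have h1 : ‖hM.eigenvectorBasis i‖ = 1 := hM.eigenvectorBasis.norm_eq_one i
    have h2 := EuclideanSpace.real_norm_sq_eq (hM.eigenvectorBasis i)
    rw [h1] at h2
    simp only [dotProduct, v]
    rw [← one_pow 2, h2]
    exact Finset.sum_congr rfl fun j _ => (sq _).symm
  have hAv : A.mulVec v = B.mulVec v - μ • v := by
    rw [← hv, Matrix.sub_mulVec]; abel
  have hsq := dotProduct_mulVec_mono h v
  rw [← Matrix.mulVec_mulVec, ← Matrix.mulVec_mulVec, dotProduct_mulVec_symm hA'.isHermitian,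
    dotProduct_mulVec_symm hB'.isHermitian, hAv] at hsq
  have hBv := hB'.dotProduct_mulVec_nonneg v
  rw [star_trivial, dotProduct_mulVec_symm hB'.isHermitian] at hBv
  simp only [sub_dotProduct, dotProduct_sub, smul_dotProduct, dotProduct_smul, smul_eq_mul,
    hvv, dotProduct_comm v] at hsq
  nlinarith [mul_nonneg (neg_nonneg.2 hneg.le) hBv, mul_pos_of_neg_of_neg hneg hneg]

theorem sqrt_le_of_le_mul_self {A B : Matrix n n ℝ} (hA : 0 ≤ A) (hB : 0 ≤ B) (h : A ≤ B * B) :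
    CFC.sqrt A ≤ B :=
  le_of_mul_self_le_mul_self (CFC.sqrt_nonneg A) hB (by rwa [CFC.sqrt_mul_sqrt_self A hA])

theorem le_sqrt_of_mul_self_le {A B : Matrix n n ℝ} (hA : 0 ≤ A) (hB : 0 ≤ B) (h : B * B ≤ A) :
    B ≤ CFC.sqrt A :=
  le_of_mul_self_le_mul_self hB (CFC.sqrt_nonneg A) (by rwa [CFC.sqrt_mul_sqrt_self A hA])

theorem sqrt_le_smul_sqrt {A B : Matrix n n ℝ} (hA : 0 ≤ A) (hB : 0 ≤ B) {c : ℝ} (hc : 0 ≤ c)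
    (h : A ≤ (c * c) • B) : CFC.sqrt A ≤ c • CFC.sqrt B := by
  refine sqrt_le_of_le_mul_self hA (smul_nonneg hc (CFC.sqrt_nonneg B)) ?_
  rwa [smul_mul_smul_comm, CFC.sqrt_mul_sqrt_self B hB]

theorem sqrt_mono {A B : Matrix n n ℝ} (hA : 0 ≤ A) (h : A ≤ B) : CFC.sqrt A ≤ CFC.sqrt B := by
  simpa using sqrt_le_smul_sqrt hA (hA.trans h) zero_le_one (by simpa using h)

theorem one_le_sqrt_one_add {G : Matrix n n ℝ} (hG : 0 ≤ G) : 1 ≤ CFC.sqrt (1 + G) := by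
  have h1 : (0 : Matrix n n ℝ) ≤ 1 := zero_le_one
  exact le_sqrt_of_mul_self_le (add_nonneg h1 hG) h1 (by simpa using hG)

theorem sqrt_one_add_le_one_add_sqrt {G : Matrix n n ℝ} (hG : 0 ≤ G) :
    CFC.sqrt (1 + G) ≤ 1 + CFC.sqrt G := by
  have h1 : (0 : Matrix n n ℝ) ≤ 1 := zero_le_one
  have hS := CFC.sqrt_nonneg G
  refine sqrt_le_of_le_mul_self (add_nonneg h1 hG) (add_nonneg h1 hS) ?_
  have h2 : (1 + CFC.sqrt G) * (1 + CFC.sqrt G) = (1 + G) + (CFC.sqrt G + CFC.sqrt G) := by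
    have h3 := CFC.sqrt_mul_sqrt_self G hG
    rw [mul_add, add_mul, add_mul, h3, one_mul, one_mul, mul_one]; abel
  rw [h2]
  exact le_add_of_nonneg_right (add_nonneg hS hS)

theorem sqrt_one_add_le_one_add {G : Matrix n n ℝ} (hG : 0 ≤ G) : CFC.sqrt (1 + G) ≤ 1 + G := by
  have h1 : (0 : Matrix n n ℝ) ≤ 1 := zero_le_one
  refine sqrt_le_of_le_mul_self (add_nonneg h1 hG) (add_nonneg h1 hG) ?_
  have h2 : (1 + G) * (1 + G) = (1 + G) + (G + G * G) := by noncomm_ring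
  have hGG : 0 ≤ G * G := by
    have := Matrix.posSemidef_conjTranspose_mul_self G
    rw [(Matrix.nonneg_iff_posSemidef.1 hG).isHermitian.eq] at this
    exact Matrix.nonneg_iff_posSemidef.2 this
  rw [h2]
  exact le_add_of_nonneg_right (add_nonneg hG hGG)

theorem le_trace_smul_one {S : Matrix n n ℝ} (hS : 0 ≤ S) : S ≤ S.trace • 1 := by
  set R := CFC.sqrt S
  have hR : R * R = S := CFC.sqrt_mul_sqrt_self S hS
  have hRh : R.IsHermitian := (Matrix.nonneg_iff_posSemidef.1 (CFC.sqrt_nonneg S)).isHermitian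
  have hSh := (Matrix.nonneg_iff_posSemidef.1 hS).isHermitian
  rw [Matrix.le_iff]
  refine Matrix.PosSemidef.of_dotProduct_mulVec_nonneg ?_ fun x => ?_
  · refine Matrix.IsHermitian.sub ?_ hSh
    simp [Matrix.IsHermitian]
  rw [star_trivial, Matrix.sub_mulVec, dotProduct_sub, Matrix.smul_mulVec, Matrix.one_mulVec,
    dotProduct_smul, smul_eq_mul, sub_nonneg]
  have htr : S.trace = ∑ i, ∑ j, R i j ^ 2 := by
    rw [← hR, Matrix.trace]
    refine Finset.sum_congr rfl fun i _ => ?_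
    rw [Matrix.diag_apply, Matrix.mul_apply]
    refine Finset.sum_congr rfl fun j _ => ?_
    have : R j i = R i j := by simpa using hRh.apply i j
    rw [this, sq]
  rw [← hR, ← Matrix.mulVec_mulVec, dotProduct_mulVec_symm hRh, hR, htr, Finset.sum_mul]
  refine Finset.sum_le_sum fun i _ => ?_
  rw [← sq, dotProduct, Matrix.mulVec, dotProduct]
  simpa only [← sq] using Finset.sum_mul_sq_le_sq_mul_sq Finset.univ (R i) x

theorem mul_self_le_trace_smul {S : Matrix n n ℝ} (hS : 0 ≤ S) : S * S ≤ S.trace • S := by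
  set R := CFC.sqrt S
  have hR : R * R = S := CFC.sqrt_mul_sqrt_self S hS
  have hRh : R.IsHermitian := (Matrix.nonneg_iff_posSemidef.1 (CFC.sqrt_nonneg S)).isHermitian
  have h := (Matrix.le_iff.1 (le_trace_smul_one hS)).mul_mul_conjTranspose_same R
  rw [hRh.eq] at h
  rw [Matrix.le_iff]
  convert h using 1
  rw [mul_sub, sub_mul]
  congr 1
  · simp [hR]
  · rw [← hR]; simp only [mul_assoc]

theorem trace_mul_self_eq_sum_eigenvalues_sq {S : Matrix n n ℝ} (hS : S.IsHermitian) :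
    (S * S).trace = ∑ i, hS.eigenvalues i ^ 2 := by
  conv_lhs => rw [hS.spectral_theorem]
  rw [← map_mul, Unitary.conjStarAlgAut_apply, Matrix.trace_mul_cycle]
  simp [Matrix.trace, sq]

/-- For a positive semidefinite `S` of rank at most `r`, `2 tr S ≤ r + tr S²`: each nonzero
eigenvalue `μ` satisfies `2 μ ≤ 1 + μ²`. -/
theorem two_mul_trace_le_rank_add {S : Matrix n n ℝ} (hS : S.IsHermitian) :
    2 * S.trace ≤ S.rank + (S * S).trace := by
  have hr : (S.rank : ℝ) = ∑ i, if hS.eigenvalues i ≠ 0 then (1 : ℝ) else 0 := by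
    rw [hS.rank_eq_card_non_zero_eigs, Fintype.card_subtype, Finset.sum_boole]
  rw [trace_mul_self_eq_sum_eigenvalues_sq hS, hS.trace_eq_sum_eigenvalues, hr,
    ← Finset.sum_add_distrib, Finset.mul_sum]
  refine Finset.sum_le_sum fun i _ => ?_
  split_ifs with h
  · simp only [RCLike.ofReal_real_eq_id, id_eq]
    nlinarith [sq_nonneg (hS.eigenvalues i - 1)]
  · simp only [ne_eq, not_not] at h
    simp [h]

/-- The telescoping step of AdaGrad: if `P² = Q² + g gᵀ`, then `gᵀ P⁻¹ g ≤ 2 (tr P - tr Q)`, because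
`gᵀ P⁻¹ g = tr (P⁻¹ (P² - Q²))` and `(P - Q) P⁻¹ (P - Q)` is positive semidefinite. -/
theorem dotProduct_inv_mulVec_le_trace_sub {P Q : Matrix n n ℝ} (hP : P.PosDef)
    (hQ : Q.IsHermitian) (g : n → ℝ) (h : P * P = Q * Q + Matrix.vecMulVec g g) :
    g ⬝ᵥ P⁻¹.mulVec g ≤ 2 * (P.trace - Q.trace) := by
  have hu : IsUnit P.det := hP.det_pos.ne'.isUnit
  have h1 : g ⬝ᵥ P⁻¹.mulVec g = (P⁻¹ * (P * P - Q * Q)).trace := by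
    rw [h, add_sub_cancel_left, Matrix.mul_vecMulVec, Matrix.trace_vecMulVec, dotProduct_comm]
  have h2 := (hP.inv.posSemidef.mul_mul_conjTranspose_same (P - Q)).trace_nonneg
  rw [(hP.isHermitian.sub hQ).eq] at h2
  have h3 : (P - Q) * P⁻¹ * (P - Q) = P - Q - Q + Q * P⁻¹ * Q := by
    have e1 := Matrix.mul_nonsing_inv P hu
    have e2 := Matrix.nonsing_inv_mul P hu
    calc (P - Q) * P⁻¹ * (P - Q)
        = (P * P⁻¹) * P - (P * P⁻¹) * Q - Q * (P⁻¹ * P) + Q * P⁻¹ * Q := by noncomm_ring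
      _ = _ := by rw [e1, e2, one_mul, one_mul, mul_one]
  have h4 : P⁻¹ * (P * P - Q * Q) = P - P⁻¹ * Q * Q := by
    rw [mul_sub, ← mul_assoc, Matrix.nonsing_inv_mul P hu, one_mul, mul_assoc]
  have h5 : (P⁻¹ * Q * Q).trace = (Q * P⁻¹ * Q).trace := by
    rw [Matrix.trace_mul_cycle Q P⁻¹ Q, mul_assoc, Matrix.trace_mul_comm]
  rw [h3] at h2
  rw [h1, h4, Matrix.trace_sub, h5]
  simp only [Matrix.trace_add, Matrix.trace_sub] at h2
  linarith

/-- The Fenchel–Young inequality for the quadratic form `xᵀ P x / (4 η)`, combined with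
`dotProduct_inv_mulVec_le_trace_sub`. -/
theorem dotProduct_sub_quad_le_trace_sub {P Q : Matrix n n ℝ} (hP : P.PosDef)
    (hQ : Q.IsHermitian) (g x : n → ℝ) (h : P * P = Q * Q + Matrix.vecMulVec g g) {η : ℝ}
    (hη : 0 < η) :
    x ⬝ᵥ g - 1 / (4 * η) * (x ⬝ᵥ P.mulVec x) ≤ 2 * η * (P.trace - Q.trace) := by
  have hu : IsUnit P.det := hP.det_pos.ne'.isUnit
  have h1 := dotProduct_inv_mulVec_le_trace_sub hP hQ g h
  set y := P⁻¹.mulVec g with hy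
  have hPy : P.mulVec y = g := by
    rw [hy, Matrix.mulVec_mulVec, Matrix.mul_nonsing_inv P hu, Matrix.one_mulVec]
  have h2 := hP.posSemidef.dotProduct_mulVec_nonneg (x - (2 * η) • y)
  have h3 : y ⬝ᵥ P.mulVec x = x ⬝ᵥ g := by
    rw [dotProduct_mulVec_symm hP.isHermitian, hPy, dotProduct_comm]
  simp only [star_trivial, Matrix.mulVec_sub, Matrix.mulVec_smul, hPy, sub_dotProduct,
    dotProduct_sub, smul_dotProduct, dotProduct_smul, smul_eq_mul, h3, dotProduct_comm y g] at h2
  have h4 : x ⬝ᵥ g - 1 / (4 * η) * (x ⬝ᵥ P.mulVec x) ≤ η * (g ⬝ᵥ y) := by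
    rw [sub_le_iff_le_add, ← sub_le_iff_le_add', one_div, inv_mul_eq_div,
      le_div_iff₀ (by positivity)]
    nlinarith
  nlinarith

end SqrtOrder

/-! ### The loss matrix -/

section LossMatrix

variable {d : ℕ}

theorem inner_eq_dotProduct (x y : Vec d) : ⟪x, y⟫ = x.ofLp ⬝ᵥ y.ofLp := by
  rw [EuclideanSpace.inner_eq_star_dotProduct, star_trivial, dotProduct_comm]

theorem outer_nonneg (v : Vec d) : 0 ≤ outer v := by
  have := Matrix.posSemidef_vecMulVec_self_star v.ofLp
  rw [star_trivial] at this
  exact Matrix.nonneg_iff_posSemidef.2 this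

theorem outer_smul (c : ℝ) (v : Vec d) : outer (c • v) = (c * c) • outer v := by
  simp [outer, Matrix.smul_vecMulVec, Matrix.vecMulVec_smul, smul_smul]

theorem quadForm_outer (v w : Vec d) : quadForm (outer v) w = ⟪w, v⟫ ^ 2 := by
  rw [quadForm, outer, Matrix.vecMulVec_mulVec, inner_eq_dotProduct, dotProduct_smul]
  simp [dotProduct_comm, sq]

theorem trace_outer (v : Vec d) : (outer v).trace = ‖v‖ ^ 2 := by
  rw [outer, Matrix.trace_vecMulVec, ← inner_eq_dotProduct, real_inner_self_eq_norm_sq]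

theorem quadForm_mono {A B : Matrix (Fin d) (Fin d) ℝ} (h : A ≤ B) (w : Vec d) :
    quadForm A w ≤ quadForm B w :=
  dotProduct_mulVec_mono h w.ofLp

theorem quadForm_nonneg {A : Matrix (Fin d) (Fin d) ℝ} (h : 0 ≤ A) (w : Vec d) :
    0 ≤ quadForm A w := by
  simpa [quadForm] using quadForm_mono h w

theorem quadForm_smul (c : ℝ) (A : Matrix (Fin d) (Fin d) ℝ) (w : Vec d) :
    quadForm (c • A) w = c * quadForm A w := by
  simp [quadForm, Matrix.smul_mulVec]

theorem quadForm_add (A B : Matrix (Fin d) (Fin d) ℝ) (w : Vec d) :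
    quadForm (A + B) w = quadForm A w + quadForm B w := by
  simp [quadForm, Matrix.add_mulVec]

theorem quadForm_one (w : Vec d) : quadForm 1 w = ‖w‖ ^ 2 := by
  rw [quadForm, Matrix.one_mulVec, ← inner_eq_dotProduct, real_inner_self_eq_norm_sq]

theorem quadForm_sum {ι : Type} (s : Finset ι) (A : ι → Matrix (Fin d) (Fin d) ℝ) (w : Vec d) :
    quadForm (∑ i ∈ s, A i) w = ∑ i ∈ s, quadForm (A i) w := by
  simp [quadForm, Matrix.sum_mulVec, dotProduct_sum]

theorem outer_le_smul_one {v : Vec d} {c : ℝ} (hv : ‖v‖ ^ 2 ≤ c) : outer v ≤ c • 1 := by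
  refine (le_trace_smul_one (outer_nonneg v)).trans ?_
  rw [trace_outer]
  exact smul_le_smul_of_nonneg_right hv zero_le_one

variable (ℓ m : ℕ → Vec d) (T : ℕ)

theorem lossMatrix_nonneg : 0 ≤ lossMatrix ℓ m T :=
  Finset.sum_nonneg fun _ _ => outer_nonneg _

theorem quadForm_lossMatrix (w : Vec d) :
    quadForm (lossMatrix ℓ m T) w = ∑ t ∈ Finset.range T, ⟪w, ℓ t - m t⟫ ^ 2 := by
  simp [lossMatrix, quadForm_sum, quadForm_outer]

theorem rank_lossMatrix_le : (lossMatrix ℓ m T).rank ≤ T := by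
  let M : Matrix (Fin T) (Fin d) ℝ := Matrix.of fun t i => (ℓ t - m t) i
  have h : lossMatrix ℓ m T = M.transpose * M := by
    ext i j
    simp [lossMatrix, Matrix.sum_apply, outer, Matrix.vecMulVec_apply, Matrix.mul_apply, M,
      Finset.sum_range]
  rw [h, Matrix.rank_transpose_mul_self]
  simpa using M.rank_le_height

theorem trace_sqrt_lossMatrix_nonneg : 0 ≤ (CFC.sqrt (lossMatrix ℓ m T)).trace :=
  (Matrix.nonneg_iff_posSemidef.1 (CFC.sqrt_nonneg _)).trace_nonneg

variable {ℓ m T}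

/-- The bound does not involve the dimension, because the loss matrix has rank at most `T`. -/
theorem trace_sqrt_lossMatrix_le (hℓ : ∀ t < T, ‖ℓ t - m t‖ ≤ 1) :
    (CFC.sqrt (lossMatrix ℓ m T)).trace ≤ T := by
  set S := CFC.sqrt (lossMatrix ℓ m T)
  have hS : S.IsHermitian := (Matrix.nonneg_iff_posSemidef.1 (CFC.sqrt_nonneg _)).isHermitian
  have hSS : S * S = lossMatrix ℓ m T := CFC.sqrt_mul_sqrt_self _ (lossMatrix_nonneg ℓ m T)
  have hrank : S.rank ≤ T := by
    have := Matrix.rank_transpose_mul_self S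
    rw [show S.transpose = S by simpa using hS.eq, hSS] at this
    rw [← this]
    exact rank_lossMatrix_le ℓ m T
  have htr : (S * S).trace ≤ T := by
    rw [hSS, lossMatrix, Matrix.trace_sum]
    calc ∑ t ∈ Finset.range T, (outer (ℓ t - m t)).trace
        ≤ ∑ _t ∈ Finset.range T, (1 : ℝ) := Finset.sum_le_sum fun t ht => by
          rw [trace_outer]
          exact pow_le_one₀ (norm_nonneg _) (hℓ t (Finset.mem_range.1 ht))
      _ = T := by simp
  have h := two_mul_trace_le_rank_add hS
  have : (S.rank : ℝ) ≤ T := by exact_mod_cast hrank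
  linarith

theorem norm_sq_le_quadForm_sqrt (ℓ m : ℕ → Vec d) (T : ℕ) (u : Vec d) :
    ‖u‖ ^ 2 ≤ quadForm (CFC.sqrt (1 + lossMatrix ℓ m T)) u := by
  rw [← quadForm_one]
  exact quadForm_mono (one_le_sqrt_one_add (lossMatrix_nonneg ℓ m T)) u

theorem quadForm_sqrt_le (hℓ : ∀ t < T, ‖ℓ t - m t‖ ≤ 1) (u : Vec d) :
    quadForm (CFC.sqrt (1 + lossMatrix ℓ m T)) u ≤ (1 + T) * ‖u‖ ^ 2 := by
  refine (quadForm_mono (sqrt_one_add_le_one_add (lossMatrix_nonneg ℓ m T)) u).trans ?_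
  rw [quadForm_add, quadForm_one, quadForm_lossMatrix, add_mul, one_mul]
  gcongr
  calc ∑ t ∈ Finset.range T, ⟪u, ℓ t - m t⟫ ^ 2
      ≤ ∑ _t ∈ Finset.range T, ‖u‖ ^ 2 := Finset.sum_le_sum fun t ht => by
        rw [← sq_abs]
        gcongr
        exact (abs_real_inner_le_norm _ _).trans
          (mul_le_of_le_one_right (norm_nonneg _) (hℓ t (Finset.mem_range.1 ht)))
    _ = T * ‖u‖ ^ 2 := by simp

/-- `L = S² ≤ (tr S) S ≤ (tr S) (1 + L)^{1/2}` for `S = L^{1/2}`. -/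
theorem quadForm_lossMatrix_le (ℓ m : ℕ → Vec d) (T : ℕ) (u : Vec d) :
    quadForm (lossMatrix ℓ m T) u ≤
      quadForm (CFC.sqrt (1 + lossMatrix ℓ m T)) u * (CFC.sqrt (lossMatrix ℓ m T)).trace := by
  set L := lossMatrix ℓ m T
  have hL : 0 ≤ L := lossMatrix_nonneg ℓ m T
  have h1 := quadForm_mono (mul_self_le_trace_smul (CFC.sqrt_nonneg L)) u
  rw [CFC.sqrt_mul_sqrt_self L hL, quadForm_smul] at h1
  have h2 := quadForm_mono (sqrt_mono hL (le_add_of_nonneg_left zero_le_one : L ≤ 1 + L)) u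
  rw [mul_comm]
  exact h1.trans (mul_le_mul_of_nonneg_left h2 (trace_sqrt_lossMatrix_nonneg ℓ m T))

end LossMatrix

/-! ### Regret of optimistic AdaGrad -/

theorem argmin_spec {α : Type} [Nonempty α] {S : Set α} {f : α → ℝ}
    (h : ∃ x ∈ S, ∀ y ∈ S, f x ≤ f y) :
    argmin S f ∈ S ∧ ∀ y ∈ S, f (argmin S f) ≤ f y := by
  obtain ⟨x, hx⟩ := h
  exact Classical.epsilon_spec (p := fun x => x ∈ S ∧ ∀ y ∈ S, f x ≤ f y) ⟨x, hx⟩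

section AdaGrad

variable {d : ℕ}

theorem continuous_quadForm (A : Matrix (Fin d) (Fin d) ℝ) : Continuous (quadForm A) := by
  unfold quadForm
  fun_prop

/-- Expansion of a quadratic function along a segment. -/
theorem quadForm_add_smul {A : Matrix (Fin d) (Fin d) ℝ} (hA : A.IsHermitian) (x v : Vec d)
    (s : ℝ) : quadForm A (x + s • v) =
      quadForm A x + 2 * s * (x.ofLp ⬝ᵥ A.mulVec v.ofLp) + s ^ 2 * quadForm A v := by
  have h : v.ofLp ⬝ᵥ A.mulVec x.ofLp = x.ofLp ⬝ᵥ A.mulVec v.ofLp := by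
    rw [dotProduct_mulVec_symm hA, dotProduct_comm]
  simp only [quadForm, WithLp.ofLp_add, WithLp.ofLp_smul, Matrix.mulVec_add, Matrix.mulVec_smul,
    add_dotProduct, dotProduct_add, smul_dotProduct, dotProduct_smul, smul_eq_mul, h]
  ring

/-- A minimiser `x` of `f w = ⟪w, c⟫ + (1/2) wᵀ A w` over a convex set satisfies
`f w ≥ f x + (1/2) (w - x)ᵀ A (w - x)` there. -/
theorem quadratic_growth_of_isMin {A : Matrix (Fin d) (Fin d) ℝ} (hA : A.IsHermitian)
    {Ω : Set (Vec d)} (hΩ : Convex ℝ Ω) (c : Vec d) {x : Vec d} (hx : x ∈ Ω)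
    (hmin : ∀ w ∈ Ω, ⟪x, c⟫ + 1 / 2 * quadForm A x ≤ ⟪w, c⟫ + 1 / 2 * quadForm A w)
    {w : Vec d} (hw : w ∈ Ω) :
    ⟪x, c⟫ + 1 / 2 * quadForm A x + 1 / 2 * quadForm A (w - x) ≤
      ⟪w, c⟫ + 1 / 2 * quadForm A w := by
  set v := w - x with hv
  have hexp := quadForm_add_smul hA x v
  set e := ⟪v, c⟫ + x.ofLp ⬝ᵥ A.mulVec v.ofLp with he
  -- `e` is the directional derivative at `x` in the direction `w - x`.
  have hseg : ∀ s : ℝ, 0 < s → s ≤ 1 → 0 ≤ e + s / 2 * quadForm A v := by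
    intro s h0 h1
    have hmem : x + s • v ∈ Ω := hΩ.add_smul_sub_mem hx hw ⟨h0.le, h1⟩
    have h2 := hmin _ hmem
    rw [hexp, inner_add_left, real_inner_smul_left] at h2
    have h3 : 0 ≤ s * (e + s / 2 * quadForm A v) := by rw [he]; linarith
    exact nonneg_of_mul_nonneg_right h3 h0
  have he0 : 0 ≤ e := by
    by_contra hneg
    push Not at hneg
    set q := |quadForm A v|
    have hq : 0 ≤ q := abs_nonneg _
    have hs : 0 < -e / (q - e) := div_pos (by linarith) (by linarith)
    have hs1 : -e / (q - e) ≤ 1 := by rw [div_le_one (by linarith)]; linarith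
    have h4 := hseg _ hs hs1
    have h5 : -e / (q - e) / 2 * quadForm A v ≤ -e / (q - e) / 2 * q := by
      gcongr; exact le_abs_self _
    have h6 : -e / (q - e) / 2 * q ≤ -e / 2 := by
      rw [div_div, div_mul_eq_mul_div, div_le_div_iff₀ (by linarith) two_pos]
      nlinarith
    linarith
  have hwx : w = x + (1 : ℝ) • v := by simp [hv]
  rw [hwx, hexp, inner_add_left, real_inner_smul_left]
  linarith

variable {Ω : Set (Vec d)} {η η' : ℝ}

theorem adaGradDecide_spec (hΩ : IsCompact Ω) (h0 : Ω.Nonempty) (η : ℝ) (σ : AdaGradState d)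
    (m : Vec d) : adaGradDecide Ω η σ m ∈ Ω ∧ ∀ w ∈ Ω,
      ⟪adaGradDecide Ω η σ m, σ.gradSum + m⟫ +
          1 / 2 * quadForm ((1 / η) • CFC.sqrt (1 + σ.gradMatrix)) (adaGradDecide Ω η σ m) ≤
        ⟪w, σ.gradSum + m⟫ + 1 / 2 * quadForm ((1 / η) • CFC.sqrt (1 + σ.gradMatrix)) w := by
  refine argmin_spec (f := fun w => ⟪w, σ.gradSum + m⟫ +
    1 / 2 * quadForm ((1 / η) • CFC.sqrt (1 + σ.gradMatrix)) w) ?_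
  have hc : Continuous fun w : Vec d => ⟪w, σ.gradSum + m⟫ +
      1 / 2 * quadForm ((1 / η) • CFC.sqrt (1 + σ.gradMatrix)) w := by
    have := continuous_quadForm ((1 / η) • CFC.sqrt (1 + σ.gradMatrix))
    fun_prop
  obtain ⟨x, hx, hmin⟩ := hΩ.exists_isMinOn h0 hc.continuousOn
  exact ⟨x, hx, fun y hy => hmin hy⟩

/-- The gradient fed to optimistic AdaGrad in round `t`. -/
def adaGradStep (Ω : Set (Vec d)) (η η' : ℝ) (ℓ m : ℕ → Vec d) (t : ℕ) : Vec d :=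
  adaGradGradient η' ((adaGrad Ω η η').play ℓ m t) (m t) (ℓ t)

variable {ℓ m : ℕ → Vec d}

theorem adaGradStep_sub (t : ℕ) : adaGradStep Ω η η' ℓ m t - m t =
    (1 + 32 * η' * ⟪(adaGrad Ω η η').play ℓ m t, ℓ t - m t⟫) • (ℓ t - m t) := by
  rw [adaGradStep, adaGradGradient, add_smul, one_smul]
  abel

theorem adaGrad_gradSum_succ (t : ℕ) :
    ((adaGrad Ω η η').state ℓ m (t + 1)).gradSum =
      ((adaGrad Ω η η').state ℓ m t).gradSum + adaGradStep Ω η η' ℓ m t := rfl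

theorem adaGrad_gradMatrix_succ (t : ℕ) :
    ((adaGrad Ω η η').state ℓ m (t + 1)).gradMatrix =
      ((adaGrad Ω η η').state ℓ m t).gradMatrix +
        outer (adaGradStep Ω η η' ℓ m t - m t) := rfl

theorem adaGrad_gradMatrix_nonneg (t : ℕ) :
    0 ≤ ((adaGrad Ω η η').state ℓ m t).gradMatrix := by
  induction t with
  | zero => exact le_rfl
  | succ t ih => rw [adaGrad_gradMatrix_succ]; exact add_nonneg ih (outer_nonneg _)

/-- If the gradient deviates from the prediction by at most `3/2`, then `(I + G)^{1/2}` at most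
doubles in one round, which lets the current regulariser be replaced by the next one. -/
theorem sqrt_one_add_outer_le {G : Matrix (Fin d) (Fin d) ℝ} (hG : 0 ≤ G) {g : Vec d}
    (hg : ‖g‖ ≤ 3 / 2) :
    CFC.sqrt (1 + (G + outer g)) ≤ (2 : ℝ) • CFC.sqrt (1 + G) := by
  have h1 : (0 : Matrix (Fin d) (Fin d) ℝ) ≤ 1 := zero_le_one
  refine sqrt_le_smul_sqrt (add_nonneg h1 (add_nonneg hG (outer_nonneg g))) (add_nonneg h1 hG)
    zero_le_two ?_
  have h2 : outer g ≤ (3 : ℝ) • 1 :=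
    outer_le_smul_one (by nlinarith [norm_nonneg g])
  have h3 : ((2 : ℝ) * 2) • (1 + G) = (1 + (G + (3 : ℝ) • 1)) + (3 : ℝ) • G := by
    module
  rw [h3]
  exact (by gcongr : 1 + (G + outer g) ≤ 1 + (G + (3 : ℝ) • 1)).trans
    (le_add_of_nonneg_right (smul_nonneg (by norm_num) hG))

/-- The penalty of one round is at most the increase of `2 η tr (I + G)^{1/2}`. -/
theorem inner_sub_quadForm_le {G : Matrix (Fin d) (Fin d) ℝ} (hG : 0 ≤ G) {g : Vec d}
    (hg : ‖g‖ ≤ 3 / 2) (hη : 0 < η) (x : Vec d) :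
    ⟪x, g⟫ - 1 / 2 * quadForm ((1 / η) • CFC.sqrt (1 + G)) x ≤
      2 * η * ((CFC.sqrt (1 + (G + outer g))).trace - (CFC.sqrt (1 + G)).trace) := by
  have h1 : (0 : Matrix (Fin d) (Fin d) ℝ) ≤ 1 := zero_le_one
  have hG' : 0 ≤ G + outer g := add_nonneg hG (outer_nonneg g)
  have hQ := (Matrix.nonneg_iff_posSemidef.1 (CFC.sqrt_nonneg (1 + G))).isHermitian
  have hP : (CFC.sqrt (1 + (G + outer g))).PosDef := by
    have := Matrix.PosDef.one.add_posSemidef (Matrix.le_iff.1 (one_le_sqrt_one_add hG'))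
    rwa [add_sub_cancel] at this
  have hPQ : CFC.sqrt (1 + (G + outer g)) * CFC.sqrt (1 + (G + outer g)) =
      CFC.sqrt (1 + G) * CFC.sqrt (1 + G) + Matrix.vecMulVec g.ofLp g.ofLp := by
    rw [CFC.sqrt_mul_sqrt_self _ (add_nonneg h1 hG'), CFC.sqrt_mul_sqrt_self _ (add_nonneg h1 hG),
      outer, add_assoc]
  have h2 := dotProduct_sub_quad_le_trace_sub hP hQ g.ofLp x.ofLp hPQ hη
  have h3 := quadForm_mono (sqrt_one_add_outer_le hG hg) x
  rw [quadForm_smul] at h3 ⊢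
  rw [← inner_eq_dotProduct] at h2
  change ⟪x, g⟫ - 1 / (4 * η) * quadForm (CFC.sqrt (1 + (G + outer g))) x ≤ _ at h2
  refine le_trans ?_ h2
  have h4 : 1 / (4 * η) * quadForm (CFC.sqrt (1 + (G + outer g))) x ≤
      1 / (4 * η) * (2 * quadForm (CFC.sqrt (1 + G)) x) := by gcongr
  have h5 : 1 / (4 * η) * (2 * quadForm (CFC.sqrt (1 + G)) x) =
      1 / 2 * (1 / η * quadForm (CFC.sqrt (1 + G)) x) := by field_simp; ring
  linarith

/-- The invariant of optimistic follow-the-regularised-leader: the regularised cumulative loss of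
every point of `Ω` dominates the loss of the learner, up to the accumulated penalties. -/
theorem adaGrad_potential (hΩ : IsCompact Ω) (h0 : Ω.Nonempty) (hconv : Convex ℝ Ω) (hη : 0 < η)
    {T : ℕ} (hg : ∀ t < T, ‖adaGradStep Ω η η' ℓ m t - m t‖ ≤ 3 / 2) (w : Vec d) (hw : w ∈ Ω) :
    ∑ t ∈ Finset.range T, ⟪(adaGrad Ω η η').play ℓ m t, adaGradStep Ω η η' ℓ m t⟫ -
        2 * η * ((CFC.sqrt (1 + ((adaGrad Ω η η').state ℓ m T).gradMatrix)).trace - d) ≤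
      ⟪w, ((adaGrad Ω η η').state ℓ m T).gradSum⟫ + 1 / 2 *
        quadForm ((1 / η) • CFC.sqrt (1 + ((adaGrad Ω η η').state ℓ m T).gradMatrix)) w := by
  induction T generalizing w with
  | zero =>
    have h : (adaGrad Ω η η').state ℓ m 0 = ⟨0, 0⟩ := rfl
    have h1 : 0 ≤ quadForm ((1 / η) • CFC.sqrt (1 + (0 : Matrix (Fin d) (Fin d) ℝ))) w :=
      quadForm_nonneg (smul_nonneg (by positivity) (CFC.sqrt_nonneg _)) w
    rw [h]
    simp only [Finset.range_zero, Finset.sum_empty, inner_zero_right]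
    have h2 : CFC.sqrt (1 + (0 : Matrix (Fin d) (Fin d) ℝ)) = 1 := by simp
    rw [h2] at h1 ⊢
    simp only [Matrix.trace_one, Fintype.card_fin]
    linarith
  | succ T ih =>
    have hgT := hg T (Nat.lt_succ_self T)
    set σ := (adaGrad Ω η η').state ℓ m T with hσ
    set x := (adaGrad Ω η η').play ℓ m T with hx
    set g := adaGradStep Ω η η' ℓ m T with hgdef
    have hG : 0 ≤ σ.gradMatrix := adaGrad_gradMatrix_nonneg T
    obtain ⟨hxΩ, hmin⟩ := adaGradDecide_spec hΩ h0 η σ (m T)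
    change x ∈ Ω at hxΩ
    have hherm : ((1 / η) • CFC.sqrt (1 + σ.gradMatrix)).IsHermitian :=
      (Matrix.nonneg_iff_posSemidef.1
        (smul_nonneg (by positivity) (CFC.sqrt_nonneg _))).isHermitian
    have hgrow := quadratic_growth_of_isMin hherm hconv (σ.gradSum + m T) hxΩ hmin hw
    have hpen := inner_sub_quadForm_le hG hgT hη (x - w)
    have hIH := ih (fun t ht => hg t (ht.trans (Nat.lt_succ_self T))) x hxΩ
    have hneg : quadForm ((1 / η) • CFC.sqrt (1 + σ.gradMatrix)) (x - w) =
        quadForm ((1 / η) • CFC.sqrt (1 + σ.gradMatrix)) (w - x) := by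
      rw [← neg_sub w x]; simp [quadForm, Matrix.mulVec_neg, -neg_sub]
    have hmono : quadForm ((1 / η) • CFC.sqrt (1 + σ.gradMatrix)) w ≤
        quadForm ((1 / η) • CFC.sqrt (1 + (σ.gradMatrix + outer (g - m T)))) w := by
      refine quadForm_mono (smul_le_smul_of_nonneg_left (sqrt_mono ?_ ?_) (by positivity)) w
      · exact add_nonneg zero_le_one hG
      · gcongr; exact le_add_of_nonneg_right (outer_nonneg _)
    rw [Finset.sum_range_succ, adaGrad_gradSum_succ, adaGrad_gradMatrix_succ]
    rw [hneg] at hpen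
    simp only [inner_add_right, inner_sub_left, inner_sub_right] at hgrow hpen ⊢
    linarith

theorem adaGrad_play_mem (hΩ : IsCompact Ω) (h0 : Ω.Nonempty) (t : ℕ) :
    (adaGrad Ω η η').play ℓ m t ∈ Ω :=
  (adaGradDecide_spec hΩ h0 η ((adaGrad Ω η η').state ℓ m t) (m t)).1

theorem adaGrad_gradMatrix_eq_sum (T : ℕ) :
    ((adaGrad Ω η η').state ℓ m T).gradMatrix =
      ∑ t ∈ Finset.range T, outer (adaGradStep Ω η η' ℓ m t - m t) := by
  induction T with
  | zero => rfl
  | succ T ih => rw [adaGrad_gradMatrix_succ, ih, Finset.sum_range_succ]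

/-- Regret of optimistic AdaGrad on the linearised losses `⟪·, ∇_t⟫`. -/
theorem adaGrad_linear_regret_le (hΩ : IsCompact Ω) (h0 : Ω.Nonempty) (hconv : Convex ℝ Ω)
    (hη : 0 < η) {T : ℕ} (hℓ : ∀ t < T, ‖ℓ t - m t‖ ≤ 1)
    (hc : ∀ t < T, |32 * η' * ⟪(adaGrad Ω η η').play ℓ m t, ℓ t - m t⟫| ≤ 1 / 2)
    {u : Vec d} (hu : u ∈ Ω) :
    ∑ t ∈ Finset.range T, ⟪(adaGrad Ω η η').play ℓ m t - u, adaGradStep Ω η η' ℓ m t⟫ ≤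
      3 / (4 * η) * quadForm (CFC.sqrt (1 + lossMatrix ℓ m T)) u +
        3 * η * (CFC.sqrt (lossMatrix ℓ m T)).trace := by
  have hg : ∀ t < T, ‖adaGradStep Ω η η' ℓ m t - m t‖ ≤ 3 / 2 := by
    intro t ht
    have h := abs_le.1 (hc t ht)
    rw [adaGradStep_sub, norm_smul, Real.norm_eq_abs, abs_of_nonneg (by linarith)]
    exact (mul_le_of_le_one_right (by linarith) (hℓ t ht)).trans (by linarith)
  have hpot := adaGrad_potential hΩ h0 hconv hη hg u hu
  set G := ((adaGrad Ω η η').state ℓ m T).gradMatrix with hGdef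
  set L := lossMatrix ℓ m T with hLdef
  have hL : 0 ≤ L := lossMatrix_nonneg ℓ m T
  have hG : 0 ≤ G := adaGrad_gradMatrix_nonneg T
  have hGL : G ≤ ((3 / 2 : ℝ) * (3 / 2)) • L := by
    rw [hGdef, adaGrad_gradMatrix_eq_sum, hLdef, lossMatrix, Finset.smul_sum]
    refine Finset.sum_le_sum fun t ht => ?_
    have h := abs_le.1 (hc t (Finset.mem_range.1 ht))
    rw [adaGradStep_sub, outer_smul]
    exact smul_le_smul_of_nonneg_right (by nlinarith) (outer_nonneg _)
  have h1 : (0 : Matrix (Fin d) (Fin d) ℝ) ≤ 1 := zero_le_one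
  have hquad : quadForm (CFC.sqrt (1 + G)) u ≤ 3 / 2 * quadForm (CFC.sqrt (1 + L)) u := by
    rw [← quadForm_smul]
    refine quadForm_mono
      (sqrt_le_smul_sqrt (add_nonneg h1 hG) (add_nonneg h1 hL) (by norm_num) ?_) u
    rw [smul_add]
    refine add_le_add ?_ hGL
    simpa using smul_le_smul_of_nonneg_right (by norm_num : (1 : ℝ) ≤ 3 / 2 * (3 / 2)) h1
  have htr1 : (CFC.sqrt (1 + G)).trace - d ≤ (CFC.sqrt G).trace := by
    have := trace_mono (sqrt_one_add_le_one_add_sqrt hG)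
    rw [Matrix.trace_add, Matrix.trace_one, Fintype.card_fin] at this
    linarith
  have htr2 : (CFC.sqrt G).trace ≤ 3 / 2 * (CFC.sqrt L).trace := by
    have := trace_mono (sqrt_le_smul_sqrt hG hL (by norm_num : (0 : ℝ) ≤ 3 / 2) hGL)
    rwa [Matrix.trace_smul, smul_eq_mul] at this
  have hsum : ∑ t ∈ Finset.range T, ⟪u, adaGradStep Ω η η' ℓ m t⟫ =
      ⟪u, ((adaGrad Ω η η').state ℓ m T).gradSum⟫ := by
    rw [← inner_sum]
    congr 1
    clear * -
    induction T with
    | zero => rfl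
    | succ T ih => rw [Finset.sum_range_succ, ih, adaGrad_gradSum_succ]
  simp only [inner_sub_left, Finset.sum_sub_distrib]
  rw [hsum]
  rw [quadForm_smul] at hpot
  have h2 : 2 * η * ((CFC.sqrt (1 + G)).trace - d) ≤ 2 * η * (3 / 2 * (CFC.sqrt L).trace) := by
    gcongr; exact htr1.trans htr2
  have h3 : 1 / 2 * (1 / η * quadForm (CFC.sqrt (1 + G)) u) ≤
      1 / 2 * (1 / η * (3 / 2 * quadForm (CFC.sqrt (1 + L)) u)) := by gcongr
  have h4 : 1 / 2 * (1 / η * (3 / 2 * quadForm (CFC.sqrt (1 + L)) u)) =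
      3 / (4 * η) * quadForm (CFC.sqrt (1 + L)) u := by field_simp; ring
  linarith

/-- Regret of optimistic AdaGrad on the losses corrected by `16 η' ⟪w, ℓ_t - m_t⟫²`. The correction
of the learner appears on the left, where it pays for the second-order term of the master. -/
theorem adaGrad_regret_le (hΩ : IsCompact Ω) (h0 : Ω.Nonempty) (hconv : Convex ℝ Ω)
    (hη : 0 < η) (hη' : 0 ≤ η') {r : ℝ} (hr : ∀ w ∈ Ω, ‖w‖ ≤ r) (hηr : 64 * η' * r ≤ 1) {T : ℕ}
    (hℓ : ∀ t < T, ‖ℓ t - m t‖ ≤ 1) {u : Vec d} (hu : u ∈ Ω) :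
    (adaGrad Ω η η').regret ℓ m T u +
        16 * η' * ∑ t ∈ Finset.range T, ⟪(adaGrad Ω η η').play ℓ m t, ℓ t - m t⟫ ^ 2 ≤
      16 * η' * quadForm (lossMatrix ℓ m T) u +
        (3 / (4 * η) * quadForm (CFC.sqrt (1 + lossMatrix ℓ m T)) u +
          3 * η * (CFC.sqrt (lossMatrix ℓ m T)).trace) := by
  have hc : ∀ t < T, |32 * η' * ⟪(adaGrad Ω η η').play ℓ m t, ℓ t - m t⟫| ≤ 1 / 2 := by
    intro t ht
    have h1 := (abs_real_inner_le_norm ((adaGrad Ω η η').play ℓ m t) (ℓ t - m t)).trans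
      (mul_le_of_le_one_right (norm_nonneg _) (hℓ t ht))
    have h2 := h1.trans (hr _ (adaGrad_play_mem hΩ h0 t))
    rw [abs_mul, abs_of_nonneg (by positivity)]
    nlinarith
  have hlin := adaGrad_linear_regret_le hΩ h0 hconv hη hℓ hc hu
  refine le_trans ?_ (add_le_add le_rfl hlin)
  rw [Algorithm.regret, quadForm_lossMatrix, Finset.mul_sum, Finset.mul_sum,
    ← Finset.sum_add_distrib, ← Finset.sum_add_distrib]
  refine Finset.sum_le_sum fun t _ => ?_
  set w := (adaGrad Ω η η').play ℓ m t with hw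
  have hstep : adaGradStep Ω η η' ℓ m t = ℓ t + (32 * η' * ⟪w, ℓ t - m t⟫) • (ℓ t - m t) := rfl
  rw [hstep, inner_add_right, real_inner_smul_right, inner_sub_left (y := u) (z := ℓ t - m t)]
  nlinarith [mul_nonneg hη' (sq_nonneg (⟪w, ℓ t - m t⟫ - ⟪u, ℓ t - m t⟫))]

end AdaGrad

/-! ### Entropic mirror descent on the simplex -/

section Entropy

variable {ι : Type} [Fintype ι]

theorem entropyDiv_term_nonneg {p q : ℝ} (hp : 0 ≤ p) (hq : 0 < q) :
    0 ≤ p * Real.log (p / q) - p + q := by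
  rcases hp.eq_or_lt with rfl | hp
  · simpa using hq.le
  · have h := Real.one_sub_inv_le_log_of_pos (div_pos hp hq)
    have h2 : p * (1 - (p / q)⁻¹) = p - q := by field_simp
    nlinarith [mul_le_mul_of_nonneg_left h hp.le]

theorem eq_of_entropyDiv_term_eq_zero {p q : ℝ} (hp : 0 ≤ p) (hq : 0 < q)
    (h : p * Real.log (p / q) - p + q = 0) : p = q := by
  rcases hp.eq_or_lt with rfl | hp
  · simp at h; linarith
  · by_contra hne
    have h1 : Real.log (q / p) < q / p - 1 :=
      Real.log_lt_sub_one_of_pos (div_pos hq hp) (by rw [ne_eq, div_eq_one_iff_eq hp.ne']; tauto)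
    rw [← inv_div, Real.log_inv] at h1
    have h2 : p * ((p / q)⁻¹ - 1) = q - p := by field_simp
    nlinarith [mul_lt_mul_of_pos_left h1 hp]

variable {η : ι → ℝ}

theorem entropyDiv_nonneg (hη : ∀ k, 0 < η k) {p q : ι → ℝ} (hp : ∀ k, 0 ≤ p k)
    (hq : ∀ k, 0 < q k) : 0 ≤ entropyDiv η p q :=
  Finset.sum_nonneg fun k _ =>
    mul_nonneg (one_div_nonneg.2 (hη k).le) (entropyDiv_term_nonneg (hp k) (hq k))

theorem eq_of_entropyDiv_nonpos (hη : ∀ k, 0 < η k) {p q : ι → ℝ} (hp : ∀ k, 0 ≤ p k)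
    (hq : ∀ k, 0 < q k) (h : entropyDiv η p q ≤ 0) : p = q := by
  have h0 : entropyDiv η p q = 0 := le_antisymm h (entropyDiv_nonneg hη hp hq)
  have hnn : ∀ k ∈ Finset.univ, 0 ≤ (1 / η k) * (p k * Real.log (p k / q k) - p k + q k) :=
    fun k _ => mul_nonneg (one_div_nonneg.2 (hη k).le) (entropyDiv_term_nonneg (hp k) (hq k))
  have := (Finset.sum_eq_zero_iff_of_nonneg hnn).1 h0
  funext k
  refine eq_of_entropyDiv_term_eq_zero (hp k) (hq k) ?_
  exact (mul_eq_zero.1 (this k (Finset.mem_univ k))).resolve_left (one_div_pos.2 (hη k)).ne'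

/-- Normalisation: a shift `c` of the losses turns the exponential weights into a point of the
simplex. -/
theorem exists_sum_exp_eq_one [Nonempty ι] (hη : ∀ k, 0 < η k) {q : ι → ℝ} (hq : ∀ k, 0 < q k)
    (x : ι → ℝ) : ∃ c : ℝ, ∑ k, q k * Real.exp (-(η k * (x k + c))) = 1 := by
  let f : ℝ → ℝ := fun c => ∑ k, q k * Real.exp (-(η k * (x k + c)))
  have hf : Continuous f := by fun_prop
  have hterm : ∀ k, Filter.Tendsto (fun c => q k * Real.exp (-(η k * (x k + c))))
      Filter.atTop (nhds 0) := by
    intro k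
    rw [← mul_zero (q k)]
    refine Filter.Tendsto.const_mul _ (Real.tendsto_exp_neg_atTop_nhds_zero.comp ?_)
    exact Filter.Tendsto.const_mul_atTop (hη k)
      (Filter.tendsto_atTop_add_const_left _ _ Filter.tendsto_id)
  have h0 : Filter.Tendsto f Filter.atTop (nhds 0) := by
    simpa using tendsto_finsetSum Finset.univ fun k _ => hterm k
  obtain ⟨b, hb⟩ := (h0.eventually (gt_mem_nhds zero_lt_one)).exists
  obtain ⟨k⟩ := ‹Nonempty ι›
  -- At this point the term of index `k` alone equals `1`.
  let a : ℝ := Real.log (q k) / η k - x k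
  have ha : 1 ≤ f a := by
    have h1 : q k * Real.exp (-(η k * (x k + a))) = 1 := by
      have : -(η k * (x k + a)) = -Real.log (q k) := by
        have := (hη k).ne'
        simp only [a]; field_simp; ring
      rw [this, Real.exp_neg, Real.exp_log (hq k), mul_inv_cancel₀ (hq k).ne']
    rw [← h1]
    exact Finset.single_le_sum (f := fun k => q k * Real.exp (-(η k * (x k + a))))
      (fun j _ => mul_nonneg (hq j).le (Real.exp_pos _).le) (Finset.mem_univ k)
  obtain ⟨c, hc⟩ := mem_range_of_exists_le_of_exists_ge hf ⟨b, hb.le⟩ ⟨a, ha⟩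
  exact ⟨c, hc⟩

/-- The minimiser of `⟨p, x⟩ + D(p, q)` over the simplex has positive entries, and the objective at
any `u` exceeds its minimum by exactly `D(u, p)`. -/
theorem argmin_entropyDiv_spec [Nonempty ι] (hη : ∀ k, 0 < η k) {q : ι → ℝ} (hq : ∀ k, 0 < q k)
    (x : ι → ℝ) {p : ι → ℝ}
    (hp : p = argmin (stdSimplex ℝ ι) fun p => (∑ k, p k * x k) + entropyDiv η p q) :
    p ∈ stdSimplex ℝ ι ∧ (∀ k, 0 < p k) ∧ ∀ u ∈ stdSimplex ℝ ι,
      (∑ k, u k * x k) + entropyDiv η u q =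
        (∑ k, p k * x k) + entropyDiv η p q + entropyDiv η u p := by
  obtain ⟨c, hc⟩ := exists_sum_exp_eq_one hη hq x
  let r : ι → ℝ := fun k => q k * Real.exp (-(η k * (x k + c)))
  have hr : ∀ k, 0 < r k := fun k => mul_pos (hq k) (Real.exp_pos _)
  have hrS : r ∈ stdSimplex ℝ ι := ⟨fun k => (hr k).le, hc⟩
  have hobj : ∀ u ∈ stdSimplex ℝ ι, (∑ k, u k * x k) + entropyDiv η u q =
      -c + ∑ k, (1 / η k) * (q k - r k) + entropyDiv η u r := by
    intro u hu
    have hc' : c = ∑ k, u k * c := by rw [← Finset.sum_mul, hu.2, one_mul]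
    rw [hc', entropyDiv, entropyDiv, ← Finset.sum_neg_distrib, ← Finset.sum_add_distrib,
      ← Finset.sum_add_distrib, ← Finset.sum_add_distrib]
    refine Finset.sum_congr rfl fun k _ => ?_
    have hηk := (hη k).ne'
    have key : u k * Real.log (u k / q k) = u k * (Real.log (u k / r k) - η k * (x k + c)) := by
      rcases (hu.1 k).eq_or_lt with h | h
      · rw [← h, zero_mul, zero_mul]
      · have hrq : Real.log (r k) = Real.log (q k) - η k * (x k + c) := by
          rw [Real.log_mul (hq k).ne' (Real.exp_pos _).ne', Real.log_exp]; ring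
        rw [Real.log_div h.ne' (hq k).ne', Real.log_div h.ne' (hr k).ne', hrq]; ring
    rw [key]
    field_simp
    ring
  have hself : entropyDiv η r r = 0 := by
    refine Finset.sum_eq_zero fun k _ => ?_
    rw [div_self (hr k).ne', Real.log_one]; ring
  have hmin : ∀ u ∈ stdSimplex ℝ ι, (∑ k, r k * x k) + entropyDiv η r q ≤
      (∑ k, u k * x k) + entropyDiv η u q := by
    intro u hu
    rw [hobj u hu, hobj r hrS, hself]
    have := entropyDiv_nonneg hη hu.1 hr
    linarith
  have hspec := argmin_spec (f := fun p => (∑ k, p k * x k) + entropyDiv η p q) ⟨r, hrS, hmin⟩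
  rw [← hp] at hspec
  have hpr : p = r := by
    refine eq_of_entropyDiv_nonpos hη hspec.1.1 hr ?_
    have h1 := hspec.2 r hrS
    rw [hobj p hspec.1, hobj r hrS, hself] at h1
    linarith
  rw [hpr]
  refine ⟨hrS, hr, fun u hu => ?_⟩
  rw [hobj u hu, hobj r hrS, hself, add_zero]

/-- Stability of one step of entropic mirror descent: `⟨p - q, x⟩ - D(q, p)` is at most
`∑_k p_k (e^{-η_k x_k} - 1 + η_k x_k) / η_k`, hence at most `∑_k η_k p_k x_k²`. -/
theorem sum_sub_mul_sub_entropyDiv_le (hη : ∀ k, 0 < η k) {p q x : ι → ℝ} (hp : ∀ k, 0 < p k)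
    (hq : ∀ k, 0 < q k) (hx : ∀ k, |η k * x k| ≤ 1) :
    (∑ k, (p k - q k) * x k) - entropyDiv η q p ≤ ∑ k, p k * (η k * x k ^ 2) := by
  rw [entropyDiv, ← Finset.sum_sub_distrib]
  refine Finset.sum_le_sum fun k _ => ?_
  have hηk := hη k
  have h1 := Real.abs_exp_sub_one_sub_id_le (x := -(η k * x k)) (by rw [abs_neg]; exact hx k)
  have h2 := (abs_le.1 h1).2
  have h3 := Real.add_one_le_exp (-(η k * x k) - Real.log (q k / p k))
  rw [Real.exp_sub, Real.exp_log (div_pos (hq k) (hp k))] at h3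
  have h4 : q k * (Real.exp (-(η k * x k)) / (q k / p k)) = p k * Real.exp (-(η k * x k)) := by
    have := (hq k).ne'
    have := (hp k).ne'
    field_simp
  have h5 := mul_le_mul_of_nonneg_left h3 (hq k).le
  rw [h4] at h5
  have h6 := mul_le_mul_of_nonneg_left h2 (hp k).le
  have h7 : (p k - q k) * (η k * x k) - (q k * Real.log (q k / p k) - q k + p k) ≤
      p k * (η k * x k) ^ 2 := by nlinarith
  have h8 : (p k - q k) * x k - 1 / η k * (q k * Real.log (q k / p k) - q k + p k) =
      ((p k - q k) * (η k * x k) - (q k * Real.log (q k / p k) - q k + p k)) / η k := by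
    field_simp
  have h9 : p k * (η k * x k ^ 2) = p k * (η k * x k) ^ 2 / η k := by field_simp
  rw [h8, h9]
  gcongr

/-- One round of optimistic mirror descent with losses `g + b`, where the correction
`b_k = 32 η_k (g_k - h_k)²` absorbs the stability term. -/
theorem optimistic_step_le [Nonempty ι] (hη : ∀ k, 0 < η k) {q g h b : ι → ℝ} (hq : ∀ k, 0 < q k)
    (hgh : ∀ k, η k * |g k - h k| ≤ 1 / 128) (hb : ∀ k, b k = 32 * η k * (g k - h k) ^ 2)
    {p q' : ι → ℝ}
    (hp : p = argmin (stdSimplex ℝ ι) fun p => (∑ k, p k * h k) + entropyDiv η p q)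
    (hq' : q' = argmin (stdSimplex ℝ ι) fun p => (∑ k, p k * (g k + b k)) + entropyDiv η p q)
    {u : ι → ℝ} (hu : u ∈ stdSimplex ℝ ι) :
    (∑ k, p k * g k) - ∑ k, u k * (g k + b k) ≤ entropyDiv η u q - entropyDiv η u q' := by
  obtain ⟨hpS, hp0, hp3⟩ := argmin_entropyDiv_spec hη hq h hp
  obtain ⟨hqS, hq0, hq3⟩ := argmin_entropyDiv_spec hη hq (fun k => g k + b k) hq'
  have e1 := hq3 u hu
  have e2 := hp3 q' hqS
  have hpq := entropyDiv_nonneg hη (fun k => (hp0 k).le) hq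
  have hs : ∀ k, |η k * (g k + b k - h k)| ≤ 1 ∧ η k * (g k + b k - h k) ^ 2 ≤ b k := by
    intro k
    have hηk := hη k
    have h1 := hgh k
    set z := η k * (g k - h k) with hz
    have hzabs : |z| ≤ 1 / 128 := by rw [hz, abs_mul, abs_of_pos hηk]; exact h1
    have h2 : η k * (g k + b k - h k) = z * (1 + 32 * z) := by rw [hb, hz]; ring
    have hz2 := abs_le.1 hzabs
    have h3 : |1 + 32 * z| ≤ 2 := by rw [abs_le]; constructor <;> linarith
    constructor
    · rw [h2, abs_mul]
      nlinarith [abs_nonneg z, abs_nonneg (1 + 32 * z)]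
    · have h4 : (g k + b k - h k) = (g k - h k) * (1 + 32 * z) := by rw [hb, hz]; ring
      have h5 : (1 + 32 * z) ^ 2 ≤ 32 := by nlinarith
      rw [h4, mul_pow, hb k]
      have h6 : 0 ≤ η k * (g k - h k) ^ 2 := by positivity
      nlinarith
  have e3 := sum_sub_mul_sub_entropyDiv_le hη hp0 hq0 fun k => (hs k).1
  have e4 : ∑ k, p k * (η k * (g k + b k - h k) ^ 2) ≤ ∑ k, p k * b k :=
    Finset.sum_le_sum fun k _ => mul_le_mul_of_nonneg_left (hs k).2 (hp0 k).le
  have e5 : ∑ k, (p k - q' k) * (g k + b k - h k) = ∑ k, p k * g k + ∑ k, p k * b k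
      - ∑ k, p k * h k - ∑ k, q' k * (g k + b k) + ∑ k, q' k * h k := by
    simp only [← Finset.sum_add_distrib, ← Finset.sum_sub_distrib]
    exact Finset.sum_congr rfl fun k _ => by ring
  linarith

end Entropy

/-! ### Regret of the master -/

section Master

variable {d : ℕ} {ι : Type} [Fintype ι] {η : ι → ℝ} {A : ι → Algorithm d} {ℓ m : ℕ → Vec d}

theorem msMwCMaster_base (Λ : Set (ι → ℝ)) (t : ℕ) (k : ι) :
    ((msMwCMaster η A Λ).state ℓ m t).base k = (A k).state ℓ m t := by
  induction t with
  | zero => rfl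
  | succ t ih =>
    change (A k).update (((msMwCMaster η A Λ).state ℓ m t).base k) (m t) (ℓ t) = _
    rw [ih]; rfl

theorem entropyDiv_single_le [DecidableEq ι] (hη : ∀ k, 0 < η k) (q : ι → ℝ) (k : ι) :
    entropyDiv η (Pi.single k 1) q ≤ 1 / η k * Real.log (1 / q k) + ∑ j, q j / η j := by
  have h : ∀ j, 1 / η j * ((Pi.single k 1 : ι → ℝ) j * Real.log ((Pi.single k 1 : ι → ℝ) j / q j) -
      (Pi.single k 1 : ι → ℝ) j + q j) ≤
      (Pi.single k (1 / η k * Real.log (1 / q k)) : ι → ℝ) j + q j / η j := by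
    intro j
    have := hη j
    rcases eq_or_ne j k with rfl | hj
    · simp only [Pi.single_eq_same]
      have h1 : 0 < 1 / η j := one_div_pos.2 this
      have h2 : 1 / η j * q j = q j / η j := by ring
      nlinarith
    · simp only [Pi.single_eq_of_ne hj]
      apply le_of_eq; ring
  refine (Finset.sum_le_sum fun j _ => h j).trans ?_
  rw [Finset.sum_add_distrib, Finset.sum_pi_single']
  simp

/-- The regret of the master exceeds that of each of its base algorithms by at most a second-order
term and the divergence from the initial weights. -/
theorem msMwCMaster_regret_le [Nonempty ι] (hη : ∀ k, 0 < η k) {T : ℕ}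
    (hA : ∀ k, ∀ t < T, η k * |⟪(A k).play ℓ m t, ℓ t - m t⟫| ≤ 1 / 128) (k : ι) (u : Vec d) :
    (msMwCMaster η A (stdSimplex ℝ ι)).regret ℓ m T u ≤
      (A k).regret ℓ m T u + 32 * η k * ∑ t ∈ Finset.range T, ⟪(A k).play ℓ m t, ℓ t - m t⟫ ^ 2 +
        (1 / η k * Real.log ((∑ j, η j ^ 2) / η k ^ 2) + (∑ j, η j) / ∑ j, η j ^ 2) := by
  classical
  set M := msMwCMaster η A (stdSimplex ℝ ι) with hM
  let e : ι → ℝ := Pi.single k 1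
  have he : e ∈ stdSimplex ℝ ι := single_mem_stdSimplex ℝ k
  have hS : 0 < ∑ j, η j ^ 2 := Finset.sum_pos (fun j _ => pow_pos (hη j) 2) Finset.univ_nonempty
  have hpos : ∀ t, ∀ j, 0 < (M.state ℓ m t).aux j := by
    intro t
    induction t with
    | zero => exact fun j => div_pos (pow_pos (hη j) 2) hS
    | succ t ih => exact (argmin_entropyDiv_spec hη ih _ rfl).2.1
  have hround : ∀ t < T, ⟪M.play ℓ m t - u, ℓ t⟫ ≤ ⟪(A k).play ℓ m t - u, ℓ t⟫ +
      32 * η k * ⟪(A k).play ℓ m t, ℓ t - m t⟫ ^ 2 +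
      (entropyDiv η e (M.state ℓ m t).aux - entropyDiv η e (M.state ℓ m (t + 1)).aux) := by
    intro t ht
    set σ := M.state ℓ m t with hσ
    have hdec : ∀ j, (A j).decide (σ.base j) (m t) = (A j).play ℓ m t := fun j => by
      rw [hσ, msMwCMaster_base]; rfl
    have hstep := optimistic_step_le hη (hpos t)
      (g := fun j => ⟪(A j).decide (σ.base j) (m t), ℓ t⟫)
      (h := fun j => ⟪(A j).decide (σ.base j) (m t), m t⟫)
      (b := fun j => 32 * η j *
        (⟪(A j).decide (σ.base j) (m t), ℓ t⟫ - ⟪(A j).decide (σ.base j) (m t), m t⟫) ^ 2)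
      (fun j => by rw [← inner_sub_right, hdec]; exact hA j t ht) (fun j => rfl)
      (p := masterWeights η A (stdSimplex ℝ ι) σ (m t))
      (q' := (M.state ℓ m (t + 1)).aux) rfl rfl he
    have hplay : ⟪M.play ℓ m t, ℓ t⟫ = ∑ j, masterWeights η A (stdSimplex ℝ ι) σ (m t) j *
        ⟪(A j).decide (σ.base j) (m t), ℓ t⟫ := by
      change ⟪∑ j, masterWeights η A (stdSimplex ℝ ι) σ (m t) j •
        (A j).decide (σ.base j) (m t), ℓ t⟫ = _
      simp [sum_inner, real_inner_smul_left]
    have hsingle : ∀ f : ι → ℝ, ∑ j, e j * f j = f k := fun f => by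
      simp [e, Pi.single_apply]
    rw [hsingle, ← hplay, ← inner_sub_right, hdec] at hstep
    simp only [inner_sub_left]
    linarith
  have hsum := Finset.sum_le_sum fun t ht => hround t (Finset.mem_range.1 ht)
  rw [Finset.sum_add_distrib, Finset.sum_add_distrib, ← Finset.mul_sum,
    Finset.sum_range_sub'] at hsum
  have hlast := entropyDiv_nonneg hη he.1 (hpos T)
  have hfirst := entropyDiv_single_le hη (M.state ℓ m 0).aux k
  have haux : ∀ j, (M.state ℓ m 0).aux j = η j ^ 2 / ∑ i, η i ^ 2 := fun j => rfl
  have hdiv : ∑ j, (M.state ℓ m 0).aux j / η j = (∑ j, η j) / ∑ j, η j ^ 2 := by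
    rw [Finset.sum_div]
    refine Finset.sum_congr rfl fun j _ => ?_
    have := (hη j).ne'
    rw [haux]; field_simp
  rw [hdiv, haux k, one_div_div] at hfirst
  rw [Algorithm.regret, Algorithm.regret]
  linarith

end Master

/-! ### The grid of parameters -/

section Grid

theorem le_two_zpow_ceil_logb {x : ℝ} (hx : 0 < x) : x ≤ 2 ^ ⌈Real.logb 2 x⌉ := by
  rw [← Real.rpow_intCast]
  calc x = 2 ^ Real.logb 2 x := (Real.rpow_logb two_pos (by norm_num) hx).symm
    _ ≤ _ := Real.rpow_le_rpow_of_exponent_le one_le_two (Int.le_ceil _)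

theorem two_zpow_ceil_logb_le {x : ℝ} (hx : 0 < x) : (2 : ℝ) ^ ⌈Real.logb 2 x⌉ ≤ 2 * x := by
  rw [← Real.rpow_intCast]
  calc (2 : ℝ) ^ (⌈Real.logb 2 x⌉ : ℝ) ≤ 2 ^ (Real.logb 2 x + 1) :=
        Real.rpow_le_rpow_of_exponent_le one_le_two (Int.ceil_lt_add_one _).le
    _ = 2 * x := by
        rw [Real.rpow_add two_pos, Real.rpow_logb two_pos (by norm_num) hx, Real.rpow_one, mul_comm]

theorem ceil_logb_mono {x y : ℝ} (hx : 0 < x) (h : x ≤ y) :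
    ⌈Real.logb 2 x⌉ ≤ ⌈Real.logb 2 y⌉ :=
  Int.ceil_le_ceil ((Real.logb_le_logb one_lt_two hx (hx.trans_le h)).2 h)

theorem neg_ceil_logb_le {T x : ℝ} (hT : 0 < T) (h : 1 / T ≤ x) :
    -⌈Real.logb 2 T⌉ ≤ ⌈Real.logb 2 x⌉ := by
  refine le_trans ?_ (ceil_logb_mono (one_div_pos.2 hT) h)
  rw [one_div, Real.logb_inv, Int.ceil_neg, neg_le_neg_iff]
  exact Int.floor_le_ceil _

theorem logb_two_le {x : ℝ} (hx : 0 < x) : Real.logb 2 x ≤ 2 * x := by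
  have h2 := Real.log_two_gt_d9
  rw [Real.logb, div_le_iff₀ (by linarith)]
  nlinarith [Real.log_le_sub_one_of_pos hx]

theorem sum_zpow_Icc_le {r : ℝ} (h0 : 0 < r) (h1 : r ≤ 1 / 2) (a b : ℤ) :
    ∑ i ∈ Finset.Icc a b, r ^ i ≤ 2 * r ^ a := by
  rcases lt_or_ge b a with hab | hab
  · rw [Finset.Icc_eq_empty (not_le.2 hab), Finset.sum_empty]; positivity
  have key : ∑ i ∈ Finset.Icc a b, r ^ i ≤ 2 * r ^ a - r ^ b := by
    induction b, hab using Int.leInduction with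
    | base => rw [Finset.Icc_self, Finset.sum_singleton]; linarith
    | succ b hab ih =>
      rw [← Finset.insert_Icc_right_eq_Icc_add_one (by omega), Finset.sum_insert (by simp),
        zpow_add_one₀ h0.ne']
      have := zpow_pos h0 b
      nlinarith
  have := zpow_pos h0 b
  linarith

theorem agRate_pos (k : ℤ × ℤ × ℤ) : 0 < agRate k := by
  unfold agRate; positivity

theorem agRate_eq (k : ℤ × ℤ × ℤ) : agRate k = 1 / 64 * ((1 / 2) ^ k.1 * (1 / 2) ^ k.2.1) := by
  rw [agRate, zpow_add₀ two_ne_zero, one_div_zpow, one_div_zpow]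
  field_simp

theorem agRate_sq_eq (k : ℤ × ℤ × ℤ) :
    agRate k ^ 2 = 1 / 4096 * ((1 / 4) ^ k.1 * (1 / 4) ^ k.2.1) := by
  have h : ∀ i : ℤ, (1 / 4 : ℝ) ^ i = ((1 / 2) ^ i) ^ 2 := fun i => by
    rw [show (1 / 4 : ℝ) = (1 / 2) * (1 / 2) by norm_num, mul_zpow, sq]
  rw [agRate_eq, h, h]; ring

theorem agRate_mul_two_zpow_le {k : ℤ × ℤ × ℤ} (hk : 1 ≤ k.2.1) :
    agRate k * 2 ^ k.1 ≤ 1 / 128 := by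
  have h1 : (2 : ℝ) ^ (1 : ℤ) ≤ 2 ^ k.2.1 := zpow_le_zpow_right₀ one_le_two hk
  rw [zpow_one] at h1
  rw [agRate, zpow_add₀ two_ne_zero, one_div_mul_eq_div,
    div_le_div_iff₀ (by positivity) (by norm_num)]
  have : (0 : ℝ) < 2 ^ k.1 := by positivity
  nlinarith

theorem sum_prod_mul (I J L : Finset ℤ) (f g : ℤ → ℝ) :
    ∑ k ∈ I ×ˢ J ×ˢ L, f k.1 * g k.2.1 = (∑ i ∈ I, f i) * (∑ j ∈ J, g j) * L.card := by
  simp only [Finset.sum_product, Finset.sum_const, nsmul_eq_mul]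
  rw [Finset.sum_mul_sum, Finset.sum_mul]
  refine Finset.sum_congr rfl fun i _ => ?_
  rw [Finset.sum_mul]
  exact Finset.sum_congr rfl fun j _ => mul_comm _ _

variable {d T : ℕ} {D : ℝ}

/-- Both sums are geometric in the first two coordinates of the grid, hence comparable to their
largest terms. -/
theorem sum_agRate_div_le {k : ℤ × ℤ × ℤ} (hk : k ∈ agGrid d T D) :
    (∑ j ∈ agGrid d T D, agRate j) / ∑ j ∈ agGrid d T D, agRate j ^ 2 ≤ 4 / agRate k := by
  simp only [agRate_sq_eq]
  simp only [agRate_eq]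
  rw [← Finset.mul_sum, ← Finset.mul_sum]
  unfold agGrid at hk ⊢
  simp only [Finset.mem_product, Finset.mem_Icc] at hk
  obtain ⟨⟨hk1, hk1'⟩, ⟨hk2, hk2'⟩, hk3, hk3'⟩ := hk
  rw [sum_prod_mul, sum_prod_mul]
  set a := -⌈Real.logb 2 T⌉ with ha
  set N : ℝ := ((Finset.Icc a ⌈Real.logb 2 (2 * D ^ 2 * T)⌉).card : ℝ) with hN
  have hNpos : 0 < N := by
    rw [hN, Nat.cast_pos, Finset.card_pos]
    exact ⟨k.2.2, Finset.mem_Icc.2 ⟨hk3, hk3'⟩⟩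
  have u1 := sum_zpow_Icc_le (r := 1 / 2) (by norm_num) le_rfl a ⌈Real.logb 2 D⌉
  have u2 := sum_zpow_Icc_le (r := 1 / 2) (by norm_num) le_rfl 1 ⌈Real.logb 2 (d * T)⌉
  have l1 : (1 / 4 : ℝ) ^ a ≤ ∑ i ∈ Finset.Icc a ⌈Real.logb 2 D⌉, (1 / 4 : ℝ) ^ i :=
    Finset.single_le_sum (f := fun i => (1 / 4 : ℝ) ^ i) (fun i _ => by positivity)
      (Finset.mem_Icc.2 ⟨le_rfl, hk1.trans hk1'⟩)
  have l2 : (1 / 4 : ℝ) ^ (1 : ℤ) ≤ ∑ i ∈ Finset.Icc 1 ⌈Real.logb 2 (d * T)⌉, (1 / 4 : ℝ) ^ i :=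
    Finset.single_le_sum (f := fun i => (1 / 4 : ℝ) ^ i) (fun i _ => by positivity)
      (Finset.mem_Icc.2 ⟨le_rfl, hk2.trans hk2'⟩)
  rw [zpow_one] at u2 l2
  have h4 : (1 / 4 : ℝ) ^ a = (1 / 2) ^ a * (1 / 2) ^ a := by
    rw [← mul_zpow]; norm_num
  set X : ℝ := (1 / 2) ^ a with hX
  have hXpos : 0 < X := by positivity
  have hk1X : (1 / 2 : ℝ) ^ k.1 ≤ X :=
    zpow_le_zpow_right_of_le_one₀ (by norm_num) (by norm_num) hk1
  have hk2X : (1 / 2 : ℝ) ^ k.2.1 ≤ 1 / 2 := by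
    simpa using zpow_le_zpow_right_of_le_one₀ (by norm_num : (0 : ℝ) < 1 / 2) (by norm_num) hk2
  have hkpos1 : (0 : ℝ) < (1 / 2) ^ k.1 := by positivity
  have hkpos2 : (0 : ℝ) < (1 / 2) ^ k.2.1 := by positivity
  rw [h4] at l1
  calc _ ≤ 1 / 64 * (2 * X * (2 * (1 / 2)) * N) / (1 / 4096 * (X * X * (1 / 4) * N)) := by
        gcongr
    _ = 4 / (1 / 64 * (X * (1 / 2))) := by field_simp; norm_num
    _ ≤ _ := by gcongr

theorem sum_agRate_sq_le (hT : 1 ≤ T) (hD : 0 < D) :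
    ∑ j ∈ agGrid d T D, agRate j ^ 2 ≤ 1 / 4096 * (36 * (T * (1 + D)) ^ 4) := by
  have hT' : (1 : ℝ) ≤ T := by exact_mod_cast hT
  simp only [agRate_sq_eq]
  rw [← Finset.mul_sum]
  unfold agGrid
  rw [sum_prod_mul]
  set a := -⌈Real.logb 2 T⌉ with ha
  have u1 := sum_zpow_Icc_le (r := 1 / 4) (by norm_num) (by norm_num) a ⌈Real.logb 2 D⌉
  have u2 := sum_zpow_Icc_le (r := 1 / 4) (by norm_num) (by norm_num) 1 ⌈Real.logb 2 (d * T)⌉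
  rw [zpow_one] at u2
  have hX : (1 / 4 : ℝ) ^ a ≤ (2 * T) ^ 2 := by
    have h1 : (1 / 4 : ℝ) ^ a = (2 ^ ⌈Real.logb 2 T⌉) ^ 2 := by
      rw [ha, one_div, inv_zpow', neg_neg, sq, ← mul_zpow]; norm_num
    rw [h1]
    gcongr
    exact two_zpow_ceil_logb_le (by linarith)
  set Z : ℝ := T * (1 + D) with hZ
  have hTZ : (T : ℝ) ≤ Z := by nlinarith
  have hDZ : D ≤ Z := by nlinarith
  have hN : ((Finset.Icc a ⌈Real.logb 2 (2 * D ^ 2 * T)⌉).card : ℝ) ≤ 9 * Z ^ 2 := by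
    have h1 := logb_two_le (show 0 < 2 * D ^ 2 * T by positivity)
    have h2 := logb_two_le (show 0 < (T : ℝ) by linarith)
    have h3 := Int.ceil_lt_add_one (Real.logb 2 (2 * D ^ 2 * T))
    have h4 := Int.ceil_lt_add_one (Real.logb 2 T)
    have hDT : D ^ 2 * T ≤ Z ^ 2 := by
      have : D ^ 2 * T ≤ (T * D) ^ 2 := by
        rw [mul_pow, mul_comm]
        gcongr
        nlinarith
      have h5 : T * D ≤ Z := by nlinarith
      exact this.trans (pow_le_pow_left₀ (by positivity) h5 2)
    rw [Int.card_Icc]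
    rcases le_total 0 (⌈Real.logb 2 (2 * D ^ 2 * T)⌉ + 1 - a) with h | h
    · have h6 : (((⌈Real.logb 2 (2 * D ^ 2 * T)⌉ + 1 - a).toNat : ℤ) : ℝ) =
          ⌈Real.logb 2 (2 * D ^ 2 * T)⌉ + 1 + ⌈Real.logb 2 T⌉ := by
        rw [Int.toNat_of_nonneg h, ha]; push_cast; ring
      rw [Int.cast_natCast] at h6
      rw [h6]
      nlinarith
    · rw [Int.toNat_of_nonpos h]; simp; positivity
  calc _ ≤ 1 / 4096 * (2 * (2 * T) ^ 2 * (2 * (1 / 4)) * (9 * Z ^ 2)) := by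
        gcongr
        exact u1.trans (by gcongr)
    _ = 1 / 4096 * (36 * (T ^ 2 * Z ^ 2)) := by ring
    _ ≤ 1 / 4096 * (36 * (Z ^ 2 * Z ^ 2)) := by gcongr
    _ = _ := by ring

end Grid

/-! ### Tuning -/

section Tuning

variable {d T : ℕ} {D : ℝ} {K : Set (Vec d)} {ℓ m : ℕ → Vec d}

/-- The regret of the master against the expert `k`, for comparators in its decision set. -/
theorem agMaster_regret_le_expert (hK : IsCompact K) (hconv : Convex ℝ K) (h0 : 0 ∈ K)
    (hℓ : ∀ t < T, ‖ℓ t - m t‖ ≤ 1) {k : ℤ × ℤ × ℤ} (hk : k ∈ agGrid d T D) {u : Vec d}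
    (hu : u ∈ K) (huk : ‖u‖ ≤ 2 ^ k.1) :
    (agMaster K T D).regret ℓ m T u ≤
      32 * agRate k * quadForm (lossMatrix ℓ m T) u +
        (3 / (4 * (2 ^ (k.2.2 + 1) * agRate k)) * quadForm (CFC.sqrt (1 + lossMatrix ℓ m T)) u +
          3 * (2 ^ (k.2.2 + 1) * agRate k) * (CFC.sqrt (lossMatrix ℓ m T)).trace) +
        (1 / agRate k * Real.log ((∑ j ∈ agGrid d T D, agRate j ^ 2) / agRate k ^ 2) +
          4 / agRate k) := by
  have hΩ : ∀ j : ℤ × ℤ × ℤ, IsCompact (K ∩ {w : Vec d | ‖w‖ ≤ 2 ^ j.1}) := fun j =>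
    hK.inter_right (isClosed_le continuous_norm continuous_const)
  have hΩ0 : ∀ j : ℤ × ℤ × ℤ, (K ∩ {w : Vec d | ‖w‖ ≤ 2 ^ j.1}).Nonempty := fun j =>
    ⟨0, h0, by simp only [Set.mem_ofPred_eq, norm_zero]; positivity⟩
  have hone : ∀ j ∈ agGrid d T D, 1 ≤ j.2.1 := by
    intro j hj
    unfold agGrid at hj
    simp only [Finset.mem_product, Finset.mem_Icc] at hj
    exact hj.2.1.1
  have hplay : ∀ j : {k // k ∈ agGrid d T D}, ∀ t < T,
      agRate j * |⟪(agBase K j).play ℓ m t, ℓ t - m t⟫| ≤ 1 / 128 := by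
    intro j t ht
    have h1 : ‖(agBase K j).play ℓ m t‖ ≤ 2 ^ j.1.1 :=
      (adaGrad_play_mem (hΩ j) (hΩ0 j) t).2
    have h2 := (abs_real_inner_le_norm ((agBase K j).play ℓ m t) (ℓ t - m t)).trans
      (mul_le_of_le_one_right (norm_nonneg _) (hℓ t ht))
    exact (mul_le_mul_of_nonneg_left (h2.trans h1) (agRate_pos j).le).trans
      (agRate_mul_two_zpow_le (hone j j.2))
  have : Nonempty {k // k ∈ agGrid d T D} := ⟨⟨k, hk⟩⟩
  have hmaster := msMwCMaster_regret_le (η := fun k : {k // k ∈ agGrid d T D} => agRate k)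
    (A := fun k => agBase K k) (fun j => agRate_pos j) hplay ⟨k, hk⟩ u
  have hball : Convex ℝ {w : Vec d | ‖w‖ ≤ 2 ^ k.1} := by
    simpa [Metric.closedBall, dist_zero_right] using convex_closedBall (0 : Vec d) (2 ^ k.1)
  have hrate := agRate_pos k
  have hsmall := agRate_mul_two_zpow_le (hone k hk)
  have hbase := adaGrad_regret_le (η := 2 ^ (k.2.2 + 1) * agRate k) (η' := 2 * agRate k)
    (hΩ k) (hΩ0 k) (hconv.inter hball) (by positivity) (by positivity) (fun w hw => hw.2)
    (by linarith) hℓ ⟨hu, huk⟩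
  have e1 : ∑ j : {k // k ∈ agGrid d T D}, agRate j ^ 2 = ∑ j ∈ agGrid d T D, agRate j ^ 2 :=
    Finset.sum_coe_sort (agGrid d T D) fun j => agRate j ^ 2
  have e2 : ∑ j : {k // k ∈ agGrid d T D}, agRate j = ∑ j ∈ agGrid d T D, agRate j :=
    Finset.sum_coe_sort (agGrid d T D) agRate
  simp only [e1, e2] at hmaster
  have hdiv := sum_agRate_div_le hk
  have e3 : 16 * (2 * agRate k) = 32 * agRate k := by ring
  rw [e3] at hbase
  change (agBase K k).regret ℓ m T u +
    _ * ∑ t ∈ Finset.range T, ⟪(agBase K k).play ℓ m t, _⟫ ^ 2 ≤ _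
    at hbase
  change (agMaster K T D).regret ℓ m T u ≤ _ at hmaster
  linarith

/-- A grid point whose parameters match given scales `R` for the norm of the comparator, `B` for
the bound and `V` for the quadratic form, each up to a constant factor. -/
theorem exists_mem_agGrid (hdT : 2 ≤ d * T) {R B V : ℝ} (hRT : 1 / (T : ℝ) ≤ R) (hRD : R ≤ D)
    (hRB : R ≤ B) (hBR : B ≤ 4 * T * R) (hVT : 1 / (T : ℝ) ≤ V) (hVD : V ≤ 2 * D ^ 2 * T) :
    ∃ k ∈ agGrid d T D, R ≤ 2 ^ k.1 ∧ 1 / agRate k ≤ 512 * B ∧ 16 * B * agRate k ≤ 1 ∧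
      V ≤ 2 ^ k.2.2 ∧ (2 : ℝ) ^ k.2.2 ≤ 2 * V := by
  have hd1 : 1 ≤ d := Nat.one_le_iff_ne_zero.2 (by rintro rfl; simp at hdT)
  have hT1 : 1 ≤ T := Nat.one_le_iff_ne_zero.2 (by rintro rfl; simp at hdT)
  have hTpos : (0 : ℝ) < T := by exact_mod_cast hT1
  have hd1' : (1 : ℝ) ≤ d := by exact_mod_cast hd1
  have hdT' : (2 : ℝ) ≤ d * T := by exact_mod_cast hdT
  have hR : 0 < R := (one_div_pos.2 hTpos).trans_le hRT
  have hV : 0 < V := (one_div_pos.2 hTpos).trans_le hVT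
  have hB : 0 < B := hR.trans_le hRB
  -- The maximum with `2` makes the exponent at least `1`.
  set Y := max 2 (B / (4 * R)) with hYdef
  have hY2 : 2 ≤ Y := le_max_left _ _
  have hY : 0 < Y := by linarith
  have hYdT : Y ≤ d * T := by
    refine max_le hdT' ?_
    rw [div_le_iff₀ (by positivity)]
    nlinarith [mul_pos hTpos hR]
  have hYB : Y ≤ 2 * (B / R) := by
    have h1 : 1 ≤ B / R := by rwa [one_le_div hR]
    refine max_le (by linarith) ?_
    have : B / (4 * R) = B / R / 4 := by field_simp
    rw [this]; linarith
  have hRY : B ≤ 4 * (R * Y) := by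
    have h1 : B / (4 * R) ≤ Y := le_max_right _ _
    rw [div_le_iff₀ (by positivity)] at h1
    linarith
  have hRY' : R * Y ≤ 2 * B := by
    have := mul_le_mul_of_nonneg_left hYB hR.le
    have h2 : R * (2 * (B / R)) = 2 * B := by field_simp
    linarith
  have r1 := le_two_zpow_ceil_logb hR
  have r2 := two_zpow_ceil_logb_le hR
  have y1 := le_two_zpow_ceil_logb hY
  have y2 := two_zpow_ceil_logb_le hY
  refine ⟨(⌈Real.logb 2 R⌉, ⌈Real.logb 2 Y⌉, ⌈Real.logb 2 V⌉), ?_, r1, ?_, ?_,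
    le_two_zpow_ceil_logb hV, two_zpow_ceil_logb_le hV⟩
  · unfold agGrid
    simp only [Finset.mem_product, Finset.mem_Icc]
    refine ⟨⟨neg_ceil_logb_le hTpos hRT, ceil_logb_mono hR hRD⟩, ⟨?_, ceil_logb_mono hY hYdT⟩,
      neg_ceil_logb_le hTpos hVT, ceil_logb_mono hV hVD⟩
    have := ceil_logb_mono two_pos hY2
    simpa using this
  · rw [agRate, one_div_one_div, zpow_add₀ two_ne_zero]
    have : (2 : ℝ) ^ ⌈Real.logb 2 R⌉ * 2 ^ ⌈Real.logb 2 Y⌉ ≤ (2 * R) * (2 * Y) := by gcongr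
    simp only
    linarith
  · rw [agRate, zpow_add₀ two_ne_zero, mul_one_div, div_le_one (by positivity)]
    have : R * Y ≤ (2 : ℝ) ^ ⌈Real.logb 2 R⌉ * 2 ^ ⌈Real.logb 2 Y⌉ := by gcongr
    simp only
    linarith

/-- The regret bound in terms of scales `R`, `B`, `V` that dominate the norm of the comparator, the
bound to be proved and the quadratic form of the comparator. -/
theorem agMaster_regret_le_of_scales (hdT : 2 ≤ d * T) (hD : 1 / (T : ℝ) ≤ D) (hK : IsCompact K)
    (hconv : Convex ℝ K) (h0 : 0 ∈ K) (hℓ : ∀ t < T, ‖ℓ t - m t‖ ≤ 1) {u : Vec d} (hu : u ∈ K)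
    {R B V : ℝ} (hRT : 1 / (T : ℝ) ≤ R) (hRD : R ≤ D) (huR : ‖u‖ ≤ R) (hRB : R ≤ B)
    (hBR : B ≤ 4 * T * R) (hVT : 1 / (T : ℝ) ≤ V) (hVD : V ≤ 2 * D ^ 2 * T)
    (huV : quadForm (CFC.sqrt (1 + lossMatrix ℓ m T)) u ≤ V)
    (hVB : V * (CFC.sqrt (lossMatrix ℓ m T)).trace ≤ B ^ 2) :
    (agMaster K T D).regret ℓ m T u ≤ 16000 * Real.log (T * (1 + D)) * B := by
  have hT1 : 1 ≤ T := Nat.one_le_iff_ne_zero.2 (by rintro rfl; simp at hdT)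
  have hT1' : (1 : ℝ) ≤ T := by exact_mod_cast hT1
  have hDpos : 0 < D := (one_div_pos.2 (by linarith)).trans_le hD
  have hBpos : 0 < B := ((one_div_pos.2 (by linarith)).trans_le hRT).trans_le hRB
  obtain ⟨k, hk, hk1, hrate1, hrate2, hk3, hk4⟩ :=
    exists_mem_agGrid hdT hRT hRD hRB hBR hVT hVD
  have hreg := agMaster_regret_le_expert hK hconv h0 hℓ hk hu (huR.trans hk1)
  have hρ := agRate_pos k
  set ρ := agRate k with hρdef
  set τ := (CFC.sqrt (lossMatrix ℓ m T)).trace with hτdef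
  set Q := quadForm (CFC.sqrt (1 + lossMatrix ℓ m T)) u with hQdef
  have hτ : 0 ≤ τ := trace_sqrt_lossMatrix_nonneg ℓ m T
  have hL := quadForm_lossMatrix_le ℓ m T u
  have hρ' : ρ * B ≤ 1 / 16 := by linarith
  set Z : ℝ := T * (1 + D) with hZ
  have hZ2 : 2 ≤ Z := by
    have h1 : 1 ≤ T * D := by rwa [div_le_iff₀' (by linarith)] at hD
    rw [hZ]; linarith
  have hlogZ : 1 / 2 ≤ Real.log Z := by
    have h1 := Real.log_le_log two_pos hZ2
    have := Real.log_two_gt_d9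
    linarith
  have b1 : 32 * ρ * quadForm (lossMatrix ℓ m T) u ≤ 2 * B := by
    have h1 : quadForm (lossMatrix ℓ m T) u ≤ B ^ 2 :=
      hL.trans ((mul_le_mul_of_nonneg_right huV hτ).trans hVB)
    calc _ ≤ 32 * ρ * B ^ 2 := by gcongr
      _ = 32 * (ρ * B) * B := by ring
      _ ≤ 32 * (1 / 16) * B := by gcongr
      _ = 2 * B := by ring
  have b2 : 3 / (4 * (2 ^ (k.2.2 + 1) * ρ)) * Q ≤ 192 * B := by
    have hp : (0 : ℝ) < 2 ^ k.2.2 := by positivity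
    have h1 : 3 / (4 * (2 ^ (k.2.2 + 1) * ρ)) * Q = 3 / 8 * (1 / ρ) * (Q / 2 ^ k.2.2) := by
      rw [zpow_add_one₀ two_ne_zero]; field_simp; ring
    have h2 : Q / 2 ^ k.2.2 ≤ 1 := by rw [div_le_one hp]; exact huV.trans hk3
    rw [h1]
    have h3 : 3 / 8 * (1 / ρ) * (Q / 2 ^ k.2.2) ≤ 3 / 8 * (1 / ρ) * 1 := by gcongr
    linarith
  have b3 : 3 * (2 ^ (k.2.2 + 1) * ρ) * τ ≤ B := by
    rw [zpow_add_one₀ two_ne_zero]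
    calc 3 * (2 ^ k.2.2 * 2 * ρ) * τ ≤ 3 * (2 * V * 2 * ρ) * τ := by gcongr
      _ = 12 * ρ * (V * τ) := by ring
      _ ≤ 12 * ρ * B ^ 2 := by gcongr
      _ = 12 * (ρ * B) * B := by ring
      _ ≤ 12 * (1 / 16) * B := by gcongr
      _ ≤ B := by linarith
  have b4 : Real.log ((∑ j ∈ agGrid d T D, agRate j ^ 2) / ρ ^ 2) ≤ 22 * Real.log Z := by
    have hinv : 1 / ρ ≤ 2048 * Z := by
      have h1 : T * R ≤ Z := by rw [hZ]; gcongr; linarith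
      linarith
    have hsum := sum_agRate_sq_le (d := d) hT1 hDpos
    have hpos : 0 < ∑ j ∈ agGrid d T D, agRate j ^ 2 :=
      Finset.sum_pos (fun j _ => pow_pos (agRate_pos j) 2) ⟨k, hk⟩
    have h2 : (∑ j ∈ agGrid d T D, agRate j ^ 2) / ρ ^ 2 ≤ Z ^ 22 := by
      calc (∑ j ∈ agGrid d T D, agRate j ^ 2) / ρ ^ 2
          = (∑ j ∈ agGrid d T D, agRate j ^ 2) * (1 / ρ) ^ 2 := by
            rw [one_div, inv_pow, div_eq_mul_inv]
        _ ≤ 1 / 4096 * (36 * Z ^ 4) * (2048 * Z) ^ 2 := by gcongr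
        _ = 36864 * Z ^ 6 := by ring
        _ ≤ 2 ^ 16 * Z ^ 6 := by gcongr; norm_num
        _ ≤ Z ^ 16 * Z ^ 6 := by gcongr
        _ = Z ^ 22 := by ring
    have h3 := Real.log_le_log (by positivity) h2
    rwa [Real.log_pow, Nat.cast_ofNat] at h3
  have b5 : 1 / ρ * Real.log ((∑ j ∈ agGrid d T D, agRate j ^ 2) / ρ ^ 2) + 4 / ρ ≤
      512 * B * (22 * Real.log Z + 4) := by
    calc _ ≤ 1 / ρ * (22 * Real.log Z) + 4 / ρ := by gcongr
      _ = 1 / ρ * (22 * Real.log Z + 4) := by ring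
      _ ≤ _ := by gcongr
  have b6 : 1 / 2 * B ≤ Real.log Z * B := by gcongr
  linarith

theorem norm_le_agBound (u : Vec d) : ‖u‖ ≤ agBound ℓ m T u :=
  le_add_of_nonneg_right (Real.sqrt_nonneg _)

theorem quadForm_mul_trace_le_agBound_sq (u : Vec d) :
    quadForm (CFC.sqrt (1 + lossMatrix ℓ m T)) u * (CFC.sqrt (lossMatrix ℓ m T)).trace ≤
      agBound ℓ m T u ^ 2 := by
  have h0 : 0 ≤ quadForm (CFC.sqrt (1 + lossMatrix ℓ m T)) u *
      (CFC.sqrt (lossMatrix ℓ m T)).trace :=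
    mul_nonneg (quadForm_nonneg (CFC.sqrt_nonneg _) u) (trace_sqrt_lossMatrix_nonneg ℓ m T)
  rw [← Real.sqrt_le_left (by unfold agBound; positivity)]
  exact le_add_of_nonneg_left (norm_nonneg u)

theorem agBound_le (hT : 1 ≤ T) (hℓ : ∀ t < T, ‖ℓ t - m t‖ ≤ 1) (u : Vec d) :
    agBound ℓ m T u ≤ 3 * T * ‖u‖ := by
  have hT' : (1 : ℝ) ≤ T := by exact_mod_cast hT
  have hu := norm_nonneg u
  have h1 : √(quadForm (CFC.sqrt (1 + lossMatrix ℓ m T)) u *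
      (CFC.sqrt (lossMatrix ℓ m T)).trace) ≤ 2 * T * ‖u‖ := by
    rw [Real.sqrt_le_left (by positivity)]
    calc _ ≤ (1 + T) * ‖u‖ ^ 2 * T :=
          mul_le_mul (quadForm_sqrt_le hℓ u) (trace_sqrt_lossMatrix_le hℓ)
            (trace_sqrt_lossMatrix_nonneg ℓ m T) (by positivity)
      _ ≤ (T + 3 * T) * ‖u‖ ^ 2 * T := by gcongr; linarith
      _ = (2 * T * ‖u‖) ^ 2 := by ring
  unfold agBound
  nlinarith

end Tuning

end OnlineLinear
end

theorem mainTheorem6 :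
    ∃ C : ℝ, 0 < C ∧
      ∀ (d T : ℕ) (D : ℝ) (K : Set (OnlineLinear.Vec d)) (ℓ m : ℕ → OnlineLinear.Vec d),
        2 ≤ d * T → 1 / (T : ℝ) ≤ D →
        IsCompact K → Convex ℝ K → 0 ∈ K → (∀ w ∈ K, ‖w‖ ≤ D) →
        (∀ t < T, ‖ℓ t - m t‖ ≤ 1) →
        ∀ u ∈ K,
          (OnlineLinear.agMaster K T D).regret ℓ m T u ≤
              C * Real.log (T * (1 + D)) * (1 + OnlineLinear.agBound ℓ m T u) ∧
            (1 / √(T : ℝ) ≤ ‖u‖ →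
              (OnlineLinear.agMaster K T D).regret ℓ m T u ≤
                C * Real.log (T * (1 + D)) * OnlineLinear.agBound ℓ m T u) := by
  refine ⟨16000, by norm_num, ?_⟩
  intro d T D K ℓ m hdT hD hK hconv h0 hKD hℓ u hu
  have hT1 : 1 ≤ T := Nat.one_le_iff_ne_zero.2 (by rintro rfl; simp at hdT)
  have hT1' : (1 : ℝ) ≤ T := by exact_mod_cast hT1
  have hTpos : (0 : ℝ) < T := by linarith
  have hu0 := norm_nonneg u
  have huD := hKD u hu
  have hnorm := OnlineLinear.norm_le_agBound (ℓ := ℓ) (m := m) (T := T) u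
  have hsq := OnlineLinear.quadForm_mul_trace_le_agBound_sq (ℓ := ℓ) (m := m) (T := T) u
  have hle := OnlineLinear.agBound_le hT1 hℓ u
  have hVup := OnlineLinear.quadForm_sqrt_le hℓ u
  have hVlow := OnlineLinear.norm_sq_le_quadForm_sqrt ℓ m T u
  have hτ := OnlineLinear.trace_sqrt_lossMatrix_le hℓ
  have hτ0 := OnlineLinear.trace_sqrt_lossMatrix_nonneg ℓ m T
  set V := OnlineLinear.quadForm (CFC.sqrt (1 + OnlineLinear.lossMatrix ℓ m T)) u
  set τ := (CFC.sqrt (OnlineLinear.lossMatrix ℓ m T)).trace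
  set B := OnlineLinear.agBound ℓ m T u
  have hDT : 1 ≤ T * D := by rwa [div_le_iff₀' hTpos] at hD
  have hDpos : 0 < D := (one_div_pos.2 hTpos).trans_le hD
  have hVD : V ≤ 2 * D ^ 2 * T := by
    have h1 : ‖u‖ ^ 2 ≤ D ^ 2 := pow_le_pow_left₀ hu0 huD 2
    calc V ≤ (1 + T) * ‖u‖ ^ 2 := hVup
      _ ≤ (T + T) * D ^ 2 := by gcongr
      _ = 2 * D ^ 2 * T := by ring
  constructor
  · -- Small comparators are treated as if they had norm `1 / T` and quadratic form `1 / T`.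
    have hTR : 1 ≤ T * max ‖u‖ (1 / T) := by
      rw [← div_le_iff₀' hTpos]; exact le_max_right _ _
    have hR1 : 1 / (T : ℝ) ≤ 1 := by rw [div_le_one hTpos]; exact hT1'
    refine OnlineLinear.agMaster_regret_le_of_scales hdT hD hK hconv h0 hℓ hu
      (R := max ‖u‖ (1 / T)) (V := max V (1 / T)) (le_max_right _ _) (max_le huD hD)
      (le_max_left _ _) (max_le (by linarith) (by linarith)) ?_ (le_max_right _ _)
      (max_le hVD ?_) (le_max_left _ _) ?_
    · have : 3 * T * ‖u‖ ≤ 3 * T * max ‖u‖ (1 / T) := by gcongr; exact le_max_left _ _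
      linarith
    · rw [div_le_iff₀ hTpos]; nlinarith
    · have hV0 : 0 ≤ V := (sq_nonneg _).trans hVlow
      have h1 : max V (1 / T) ≤ V + 1 / T :=
        max_le (le_add_of_nonneg_right (by positivity)) (le_add_of_nonneg_left hV0)
      have h2 : 1 / T * τ ≤ 1 := by rw [one_div_mul_eq_div, div_le_one hTpos]; exact hτ
      have h3 := mul_le_mul_of_nonneg_right h1 hτ0
      nlinarith
  · intro hlarge
    have hsqT : 1 / (T : ℝ) ≤ ‖u‖ ^ 2 := by
      have := pow_le_pow_left₀ (by positivity) hlarge 2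
      rwa [div_pow, one_pow, Real.sq_sqrt hTpos.le] at this
    have hRT : 1 / (T : ℝ) ≤ ‖u‖ := by
      refine le_trans ?_ hlarge
      gcongr
      rw [Real.sqrt_le_left hTpos.le]
      nlinarith
    refine OnlineLinear.agMaster_regret_le_of_scales hdT hD hK hconv h0 hℓ hu
      (R := ‖u‖) (V := V) hRT huD le_rfl hnorm ?_ (hsqT.trans hVlow) hVD le_rfl hsq
    nlinarith [mul_nonneg hTpos.le hu0]
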